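/- Let $N\ge 2$, $0<\ell<N$, $0\le\alpha<1$, $1\le q<\infty$, $\beta<N/q$, $\alpha+\beta>0$ and $\frac1q=1+\frac{\alpha+\beta-\ell}{N}$. Let $V$ be a finite-dimensional complex normed space and let $K:\mathbb R^N\to\mathcal L(\mathbb C^N;V)$ be a measurable kernel (for instance a scalar kernel times the identity of $\mathbb C^N$) such that, for some constant $A$, (i) $|K(x)|\le A\,|x|^{\ell-N}$ for all $x\neq 0$; (ii) $|K(x-y)-K(x)|\le A\,\dfrac{|y|}{|x|^{N+1-\ell}}$ for all $x\ne 0$ and $y$ with $2|y|\le|x|$. For a Schwartz vector field $f\in\mathcal S(\mathbb R^N;\mathbb C^N)$ (in particular for $f\in C_c^\infty$) put $$T_\ell f(x)=\int_{\mathbb R^N}K(x-y)f(y)\,dy ,$$ and let $(-\Delta)^{-1}$ be the Fourier multiplier with symbol $\frac1{4\pi^2|\xi|^2}$, where $\hat h(\xi)=\int e^{-2\pi i x\cdot\xi}h(x)\,dx$. Then the integral defining $T_\ell f(x)$ converges absolutely for every such $f$ and every $x\in\mathbb R^N$, and there is a constant $C>0$ such that for all $f\in\mathcal S(\mathbb R^N;\mathbb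 C^N)$ $$\big\||x|^{-\beta}T_\ell f\big\|_{L^q}\le C\Big(\big\||x|^{\alpha}f\big\|_{L^1}+\big\||x|^{\alpha}\nabla(-\Delta)^{-1}\mathrm{div}\,f\big\|_{L^1}\Big),$$ where the right-hand side may be $+\infty$. Moreover, if $q>1$, there is a constant $C>0$ such that for all $f\in\mathcal S(\mathbb R^N;\mathbb C^N)$ $$\big\||x|^{-\beta}T_\ell f\big\|_{L^q}\le C\,\big\||x|^{\alpha}f\big\|_{L^1}+\big\||x|^{\alpha}\nabla(-\Delta)^{-1}\mathrm{div}\,f\big\|_{L^1}.$$ -/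

import Mathlib

open MeasureTheory
open scoped FourierTransform SchwartzMap ENNReal

noncomputable section

/-- The divergence `∑ j, ∂f_j/∂x_j` of a complex vector field on `ℝ^N`. -/
def divergence {N : ℕ} (f : EuclideanSpace ℝ (Fin N) → EuclideanSpace ℂ (Fin N))
    (x : EuclideanSpace ℝ (Fin N)) : ℂ :=
  ∑ j, (fderiv ℝ f x (EuclideanSpace.single j 1)) j

/-- The gradient `(∂u/∂x_1, …, ∂u/∂x_N)` of a complex function on `ℝ^N`. -/
def complexGradient {N : ℕ} (u : EuclideanSpace ℝ (Fin N) → ℂ)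
    (x : EuclideanSpace ℝ (Fin N)) : EuclideanSpace ℂ (Fin N) :=
  WithLp.toLp 2 fun j => fderiv ℝ u x (EuclideanSpace.single j 1)

/-- The operator `(-Δ)⁻¹`, as the Fourier multiplier with symbol `1 / (4π²|ξ|²)`.
The Fourier transform is normalised by `𝓕 h ξ = ∫ exp (-2πi x·ξ) h x dx`, so that `-Δ` has the
symbol `4π²|ξ|²`.  When `N ≥ 2` and `h` is the divergence of a Schwartz vector field, `𝓕 h ξ` is
rapidly decreasing and is `O(|ξ|)` at the origin, so the inverse Fourier integral converges
absolutely and is a smooth function. -/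
def invNegLaplacian {N : ℕ} (h : EuclideanSpace ℝ (Fin N) → ℂ) :
    EuclideanSpace ℝ (Fin N) → ℂ :=
  𝓕⁻ fun ξ : EuclideanSpace ℝ (Fin N) => (((2 * Real.pi * ‖ξ‖) ^ 2 : ℝ) : ℂ)⁻¹ * 𝓕 h ξ

/-- The vector field `∇ (-Δ)⁻¹ div f`. -/
def gradInvLaplacianDiv {N : ℕ} (f : EuclideanSpace ℝ (Fin N) → EuclideanSpace ℂ (Fin N)) :
    EuclideanSpace ℝ (Fin N) → EuclideanSpace ℂ (Fin N) :=
  complexGradient (invNegLaplacian (divergence f))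

/-- The convolution operator `T f (x) = ∫ K (x - y) f(y) dy` with an operator-valued kernel. -/
def convOperator {N : ℕ} {V : Type*} [NormedAddCommGroup V] [NormedSpace ℂ V]
    (K : EuclideanSpace ℝ (Fin N) → (EuclideanSpace ℂ (Fin N) →L[ℂ] V))
    (f : EuclideanSpace ℝ (Fin N) → EuclideanSpace ℂ (Fin N))
    (x : EuclideanSpace ℝ (Fin N)) : V :=
  ∫ y, K (x - y) (f y)

/-- The weighted norm `‖ |x|^γ F ‖_{L^p(ℝ^N)}`, with values in `[0, ∞]`. -/
def powerWeightNorm {N : ℕ} {G : Type*} [NormedAddCommGroup G] (γ p : ℝ)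
    (F : EuclideanSpace ℝ (Fin N) → G) : ℝ≥0∞ :=
  eLpNorm (fun x => ‖x‖ ^ γ * ‖F x‖) (ENNReal.ofReal p) volume

end

/-! Write g = ∇(-Δ)⁻¹ div f, a = ‖|x|^α f‖₁, b = ‖|x|^α g‖₁, and let φ_R be a smooth cutoff equal to
1 on |y| ≤ R/4 and 0 on |y| ≥ R/2. The operator splits as T f(x) = ∫ (K(x-y) - φ_{|x|}(y) K(x)) f(y)
dy + K(x) m(|x|), where m(R) = ∫ φ_R f.

The subtraction improves the kernel where |y| is small compared with |x|: there the smoothness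
hypothesis gains a factor |y|/|x|. A weighted Minkowski inequality
(`lintegral_rpow_lintegral_mul_le`, `exists_lintegral_remainderKernel_rpow_le`) then bounds the q-th
power of the first term by C a^q, without using g.

The second term is where cancellation enters. The field f + g is divergence-free and g is curl-free,
so integrating by parts against y_j φ_R puts every derivative on φ_R. Hence |m(R)| is at most a
constant times the integral of |f| + |g| over the ring R/4 ≤ |y| ≤ R/2
(`enorm_integral_cutoff_smul_le`). If a and b are finite, letting R → ∞ gives ∫ f = 0, and therefore
also R^α |m(R)| ≤ C a (`rpow_mul_enorm_integral_cutoff_smul_le`). Using the second bound to the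
power q-1 and the ring bound once, Tonelli yields the q-th power estimate C a^(q-1) (a + b) for this
term (`exists_lintegral_rpow_cutoff_le`).

Altogether ‖|x|^(-β) T f‖_q^q ≤ C a^(q-1) (a + b). This is at most C (a + b)^q, which is the first
inequality; when q > 1 the constant can be absorbed into the factor a^(q-1), leaving coefficient 1
on b. -/

/-! ### Integrals of powers of the norm over balls and their complements. -/

section PowerIntegrals

variable {E : Type*} [NormedAddCommGroup E] [NormedSpace ℝ E] [FiniteDimensional ℝ E]
  [MeasurableSpace E] [BorelSpace E] (μ : Measure E) [μ.IsAddHaarMeasure]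

theorem lintegral_eq_rpow_mul_lintegral_comp_smul (G : E → ℝ≥0∞) {R : ℝ} (hR : 0 < R) :
    ∫⁻ x, G x ∂μ = ENNReal.ofReal (R ^ (Module.finrank ℝ E : ℝ)) * ∫⁻ x, G (R • x) ∂μ := by
  have h := (Homeomorph.smulOfNeZero R hR.ne' (α := E)).measurableEmbedding.lintegral_map G (μ := μ)
  simp only [Homeomorph.smulOfNeZero_apply] at h
  rw [← h]
  have h2 := Measure.map_addHaar_smul μ hR.ne'
  rw [h2, lintegral_smul_measure, smul_eq_mul, ← mul_assoc, ← ENNReal.ofReal_mul (by positivity),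
    Real.rpow_natCast, abs_of_pos (by positivity), mul_inv_cancel₀ (by positivity)]
  simp

/-- The dilation x ↦ R x extracts the homogeneity factor, so the two bounds that follow only need
finiteness at radius 1. -/
theorem setLIntegral_norm_rpow_eq_smul (s : ℝ) (D : Set ℝ) {R : ℝ} (hR : 0 < R)
    (hD : MeasurableSet D) :
    ∫⁻ x in {x : E | R⁻¹ * ‖x‖ ∈ D}, ENNReal.ofReal (‖x‖ ^ s) ∂μ =
      (∫⁻ x in {x : E | ‖x‖ ∈ D}, ENNReal.ofReal (‖x‖ ^ s) ∂μ) *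
        ENNReal.ofReal (R ^ (Module.finrank ℝ E + s)) := by
  rw [← lintegral_indicator (by measurability), ← lintegral_indicator (by measurability),
    lintegral_eq_rpow_mul_lintegral_comp_smul μ _ hR, Real.rpow_add hR,
    ENNReal.ofReal_mul (by positivity), mul_comm, mul_comm (ENNReal.ofReal _), ← mul_assoc]
  congr 1
  rw [← lintegral_mul_const' _ _ (by finiteness)]
  refine lintegral_congr fun x => ?_
  have : R⁻¹ * ‖R • x‖ = ‖x‖ := by
    rw [norm_smul, Real.norm_of_nonneg hR.le, inv_mul_cancel_left₀ hR.ne']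
  classical
  simp only [Set.indicator_apply, Set.mem_ofPred_eq, this]
  split_ifs
  · rw [norm_smul, Real.norm_of_nonneg hR.le, Real.mul_rpow hR.le (norm_nonneg _), mul_comm,
      ENNReal.ofReal_mul (by positivity)]
  · simp

theorem exists_setLIntegral_ball_norm_rpow_le (hd : 1 ≤ Module.finrank ℝ E) {s : ℝ}
    (hs : 0 < Module.finrank ℝ E + s) :
    ∃ C : ℝ≥0∞, C ≠ ∞ ∧ ∀ R : ℝ, 0 < R →
      ∫⁻ x in {x : E | ‖x‖ < R}, ENNReal.ofReal (‖x‖ ^ s) ∂μ ≤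
        C * ENNReal.ofReal (R ^ (Module.finrank ℝ E + s)) := by
  refine ⟨∫⁻ x in {x : E | ‖x‖ ∈ Set.Iio 1}, ENNReal.ofReal (‖x‖ ^ s) ∂μ, ?_, fun R hR => ?_⟩
  · have h := integrableOn_ball_of_norm_le_rpow (μ := μ) (f := fun x : E => ‖x‖ ^ s) (C := 1)
      (α := -s) (r := 1) hd (by linarith) (.of_forall fun x => by
        rw [Real.norm_of_nonneg (by positivity)]; simp)
      (measurable_norm.pow_const s).aestronglyMeasurable
    have h2 := h.lintegral_lt_top
    rw [show Metric.ball (0 : E) 1 = {x : E | ‖x‖ ∈ Set.Iio 1} by ext; simp] at h2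
    exact h2.ne
  · rw [← setLIntegral_norm_rpow_eq_smul μ s _ hR measurableSet_Iio]
    refine lintegral_mono_set fun x (hx : ‖x‖ < R) => ?_
    simpa [inv_mul_lt_iff₀ hR] using hx

theorem exists_setLIntegral_compl_ball_norm_rpow_le (hd : 1 ≤ Module.finrank ℝ E) {s : ℝ}
    (hs : Module.finrank ℝ E + s < 0) :
    ∃ C : ℝ≥0∞, C ≠ ∞ ∧ ∀ R : ℝ, 0 < R →
      ∫⁻ x in {x : E | R ≤ ‖x‖}, ENNReal.ofReal (‖x‖ ^ s) ∂μ ≤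
        C * ENNReal.ofReal (R ^ (Module.finrank ℝ E + s)) := by
  have : Nontrivial E := by
    apply Module.nontrivial_of_finrank_pos (R := ℝ)
    positivity
  refine ⟨∫⁻ x in {x : E | ‖x‖ ∈ Set.Ici 1}, ENNReal.ofReal (‖x‖ ^ s) ∂μ, ?_, fun R hR => ?_⟩
  · have h : Integrable (fun x : E => (Set.Ici (1 : ℝ)).indicator (fun r => r ^ s) ‖x‖) μ := by
      rw [integrable_fun_norm_addHaar]
      have h1 : IntegrableOn (fun r : ℝ => r ^ ((Module.finrank ℝ E : ℝ) - 1 + s)) (Set.Ici 1) := by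
        rw [integrableOn_Ici_iff_integrableOn_Ioi]
        exact integrableOn_Ioi_rpow_of_lt (by linarith) one_pos
      rw [← integrable_indicator_iff measurableSet_Ici] at h1
      refine h1.integrableOn.congr_fun (fun r (hr : 0 < r) => ?_) measurableSet_Ioi
      simp only [Set.indicator_apply, smul_eq_mul]
      split_ifs
      · rw [Real.rpow_add hr, ← Real.rpow_natCast]
        congr 2
        push_cast [Nat.cast_sub hd]
        ring
      · simp
    have h2 := h.lintegral_lt_top
    rw [← lintegral_indicator (by measurability)]
    convert h2.ne using 3 with x
    simp only [Set.indicator_apply, Set.mem_ofPred_eq]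
    split_ifs <;> simp
  · rw [← setLIntegral_norm_rpow_eq_smul μ s _ hR measurableSet_Ici]
    refine lintegral_mono_set fun x (hx : R ≤ ‖x‖) => ?_
    simpa [le_inv_mul_iff₀ hR] using hx

end PowerIntegrals

/-! ### A weighted Minkowski inequality. -/

/-- An L¹ → L^q bound needs only the L^q size of each column S(·, y). Integrate S/w against the
measure w h dν, apply the power-mean inequality in y, and exchange the integrals; the normalised
columns are then uniformly bounded. -/
theorem lintegral_rpow_lintegral_mul_le {X Y : Type*} [MeasurableSpace X] [MeasurableSpace Y]
    {μ : Measure X} {ν : Measure Y} [SFinite μ] [SFinite ν] {S : X → Y → ℝ≥0∞}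
    (hS : Measurable (Function.uncurry S)) {w h : Y → ℝ≥0∞} (hw : Measurable w)
    (hh : Measurable h) (hw0 : ∀ᵐ y ∂ν, w y ≠ 0 ∧ w y ≠ ∞) {q : ℝ} (hq : 1 ≤ q) {C : ℝ≥0∞}
    (hbound : ∀ᵐ y ∂ν, ∫⁻ x, S x y ^ q ∂μ ≤ C * w y ^ q) :
    ∫⁻ x, (∫⁻ y, S x y * h y ∂ν) ^ q ∂μ ≤ C * (∫⁻ y, w y * h y ∂ν) ^ q := by
  have hq0 : 0 < q := by linarith
  set ρ := ν.withDensity (fun y => w y * h y) with hρ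
  have hρuniv : ρ Set.univ = ∫⁻ y, w y * h y ∂ν := by
    rw [hρ, withDensity_apply _ .univ, Measure.restrict_univ]
  have hT : Measurable (Function.uncurry fun x y => S x y / w y) :=
    hS.div (hw.comp measurable_snd)
  have h1 : ∀ x, ∫⁻ y, S x y * h y ∂ν = ∫⁻ y, S x y / w y ∂ρ := fun x => by
    rw [hρ, lintegral_withDensity_eq_lintegral_mul _ (by fun_prop)
      (show Measurable fun y => S x y / w y from hT.comp measurable_prodMk_left)]
    refine lintegral_congr_ae ?_
    filter_upwards [hw0] with y hy
    simp only [Pi.mul_apply]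
    rw [mul_comm (w y), mul_assoc, ENNReal.mul_div_cancel hy.1 hy.2, mul_comm]
  -- Jensen for ρ, which has total mass ∫ w h: the mass enters to the power q - 1 here and once more
  -- after Tonelli, giving the power q.
  have h2 : ∀ x, (∫⁻ y, S x y * h y ∂ν) ^ q ≤
      (∫⁻ y, (S x y / w y) ^ q ∂ρ) * ρ Set.univ ^ (q - 1) := fun x => by
    have := eLpNorm'_le_eLpNorm'_mul_rpow_measure_univ (μ := ρ) one_pos hq
      (hT.comp (measurable_prodMk_left (x := x))).aestronglyMeasurable
    simp only [eLpNorm'_eq_lintegral_enorm, enorm_eq_self, ENNReal.rpow_one, div_one,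
      Function.comp_apply, Function.uncurry_apply_pair] at this
    rw [h1]
    calc _ ≤ _ := ENNReal.rpow_le_rpow this hq0.le
      _ = _ := by
        rw [ENNReal.mul_rpow_of_nonneg _ _ hq0.le, ← ENNReal.rpow_mul, ← ENNReal.rpow_mul]
        congr 2
        · rw [one_div, inv_mul_cancel₀ hq0.ne', ENNReal.rpow_one]
        · field_simp
  calc ∫⁻ x, (∫⁻ y, S x y * h y ∂ν) ^ q ∂μ
      ≤ ∫⁻ x, (∫⁻ y, (S x y / w y) ^ q ∂ρ) * ρ Set.univ ^ (q - 1) ∂μ := lintegral_mono h2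
    _ = (∫⁻ y, ∫⁻ x, (S x y / w y) ^ q ∂μ ∂ρ) * ρ Set.univ ^ (q - 1) := by
        rw [lintegral_mul_const _ (by
          exact (hT.pow_const q).lintegral_prod_right'), lintegral_lintegral_swap]
        exact (hT.pow_const q).aemeasurable
    _ ≤ (∫⁻ _, C ∂ρ) * ρ Set.univ ^ (q - 1) := by
        refine mul_le_mul_left (lintegral_mono_ae ?_) _
        refine (withDensity_absolutelyContinuous _ _).ae_le ?_
        filter_upwards [hw0, hbound] with y hy hb
        have h3 : ∀ x, (S x y / w y) ^ q = S x y ^ q * (w y ^ q)⁻¹ := fun x => by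
          rw [ENNReal.div_rpow_of_nonneg _ _ hq0.le, div_eq_mul_inv]
        simp only [h3]
        have h4 : w y ^ q ≠ 0 := by simp [hy.1, hy.2]
        have h5 : w y ^ q ≠ ∞ := by simp [hy.1, hy.2]
        rw [lintegral_mul_const' _ _ (ENNReal.inv_ne_top.2 h4), ← div_eq_mul_inv]
        exact ENNReal.div_le_of_le_mul hb
    _ = C * (∫⁻ y, w y * h y ∂ν) ^ q := by
        rw [lintegral_const, hρuniv, mul_assoc]
        congr 1
        conv_lhs => rw [← ENNReal.rpow_one (∫⁻ y, w y * h y ∂ν)]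
        rw [← ENNReal.rpow_mul, one_mul, ← ENNReal.rpow_add_of_nonneg _ _ zero_le_one (by linarith)]
        congr 1; ring

/-! ### Differentiation of inverse Fourier integrals. -/

section FourierInv

variable {V : Type*} [NormedAddCommGroup V] [InnerProductSpace ℝ V] [FiniteDimensional ℝ V]
  [MeasurableSpace V] [BorelSpace V]

theorem contDiff_fourierInv {m : V → ℂ} {n : ℕ∞}
    (hm : ∀ k : ℕ, k ≤ n → Integrable fun ξ => ‖ξ‖ ^ k * ‖m ξ‖) : ContDiff ℝ n (𝓕⁻ m) := by
  rw [Real.fourierInv_eq_fourier_comp_neg]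
  refine Real.contDiff_fourier fun k hk => ?_
  simpa using (hm k hk).comp_neg

theorem fderiv_fourierInv_apply {m : V → ℂ} (hm : Integrable m)
    (hm1 : Integrable fun ξ => ‖ξ‖ * ‖m ξ‖) (x v : V) :
    fderiv ℝ (𝓕⁻ m) x v = 𝓕⁻ (fun ξ => 2 * Real.pi * Complex.I * (inner ℝ ξ v * m ξ)) x := by
  have hn : Integrable fun ξ => m (-ξ) := hm.comp_neg
  have hn1 : Integrable fun ξ => ‖ξ‖ * ‖m (-ξ)‖ := by simpa using hm1.comp_neg
  rw [Real.fourierInv_eq_fourier_comp_neg, Real.fourierInv_eq_fourier_comp_neg,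
    Real.fderiv_fourier hn hn1, Real.fourier_continuousLinearMap_apply]
  · refine congrFun (congrArg 𝓕 (funext fun ξ => ?_)) x
    simp only [VectorFourier.fourierSMulRight_apply, inner_neg_left]
    simp only [Complex.real_smul, smul_eq_mul]
    rw [show innerSL ℝ ξ v = inner ℝ ξ v from rfl]
    push_cast
    ring
  · refine (hn1.const_mul (2 * Real.pi * ‖innerSL ℝ (E := V)‖)).mono
      (hn.1.fourierSMulRight) (.of_forall fun ξ => ?_)
    refine (VectorFourier.norm_fourierSMulRight_le _ _ _).trans (le_of_eq ?_)
    rw [Real.norm_of_nonneg (by positivity)]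
    ring

end FourierInv

/-! ### The field ∇(-Δ)⁻¹ div f on the Fourier side: regularity, curl and divergence. -/

section Divergence

variable {N : ℕ}

local notation "E" => EuclideanSpace ℝ (Fin N)

theorem fderiv_euclidean_apply {F : E → EuclideanSpace ℂ (Fin N)} {x : E}
    (hF : DifferentiableAt ℝ F x) (v : E) (j : Fin N) :
    (fderiv ℝ F x v) j = fderiv ℝ (fun y => F y j) x v := by
  have h := ((EuclideanSpace.proj j : EuclideanSpace ℂ (Fin N) →L[ℂ] ℂ).restrictScalars
    ℝ).hasFDerivAt.comp x hF.hasFDerivAt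
  have h2 : fderiv ℝ (fun y => F y j) x = _ := h.fderiv
  rw [h2]
  rfl

/-- The components of a Schwartz vector field. -/
noncomputable def schwartzComponent (f : 𝓢(E, EuclideanSpace ℂ (Fin N))) (j : Fin N) : 𝓢(E, ℂ) :=
  f.postcompCLM (EuclideanSpace.proj j : EuclideanSpace ℂ (Fin N) →L[ℂ] ℂ)

open LineDeriv in
/-- The divergence of a Schwartz vector field, as a Schwartz function. -/
noncomputable def schwartzDivergence (f : 𝓢(E, EuclideanSpace ℂ (Fin N))) : 𝓢(E, ℂ) :=
  ∑ j, ∂_{(EuclideanSpace.single j 1 : E)} (schwartzComponent f j)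

theorem coe_schwartzDivergence (f : 𝓢(E, EuclideanSpace ℂ (Fin N))) :
    ⇑(schwartzDivergence f) = divergence f := by
  ext x
  simp only [schwartzDivergence, divergence, sum_apply]
  refine Finset.sum_congr rfl fun j _ => ?_
  rw [SchwartzMap.lineDerivOp_apply_eq_fderiv, fderiv_euclidean_apply f.differentiableAt]
  rfl

theorem fourier_schwartzDivergence (f : 𝓢(E, EuclideanSpace ℂ (Fin N))) (ξ : E) :
    𝓕 (schwartzDivergence f) ξ =
      ∑ j, (2 * Real.pi * Complex.I) * (ξ j * 𝓕 (schwartzComponent f j) ξ) := by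
  have : 𝓕 (schwartzDivergence f) = ∑ j, 𝓕 (LineDeriv.lineDerivOp
      (EuclideanSpace.single j 1 : E) (schwartzComponent f j)) :=
    map_sum (SchwartzMap.fourierTransformCLM ℂ) _ _
  rw [this, sum_apply]
  refine Finset.sum_congr rfl fun j _ => ?_
  rw [SchwartzMap.fourier_lineDerivOp_eq]
  have : (inner ℝ · (EuclideanSpace.single j 1 : E)).HasTemperateGrowth := by fun_prop
  rw [smul_apply, SchwartzMap.smulLeftCLM_apply_apply this]
  simp [EuclideanSpace.inner_single_right]

/-- The symbol of `(-Δ)⁻¹ div f` on the Fourier side. -/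
noncomputable def invLaplacianDivSymbol (f : 𝓢(E, EuclideanSpace ℂ (Fin N))) (ξ : E) : ℂ :=
  (((2 * Real.pi * ‖ξ‖) ^ 2 : ℝ) : ℂ)⁻¹ * 𝓕 (schwartzDivergence f) ξ

theorem invNegLaplacian_divergence (f : 𝓢(E, EuclideanSpace ℂ (Fin N))) :
    invNegLaplacian (divergence f) = 𝓕⁻ (invLaplacianDivSymbol f) := by
  unfold invNegLaplacian
  rw [← coe_schwartzDivergence]
  rfl

theorem aestronglyMeasurable_invLaplacianDivSymbol (f : 𝓢(E, EuclideanSpace ℂ (Fin N))) :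
    AEStronglyMeasurable (invLaplacianDivSymbol f) :=
  Measurable.aestronglyMeasurable <| by
    unfold invLaplacianDivSymbol
    have := (𝓕 (schwartzDivergence f)).continuous.measurable
    fun_prop

/-- The divergence supplies one factor |ξ| against the |ξ|⁻² of the inverse Laplacian, so only a
singularity |ξ|⁻¹ remains. All integrability of the symbol comes from this bound. -/
theorem norm_mul_norm_invLaplacianDivSymbol_le (f : 𝓢(E, EuclideanSpace ℂ (Fin N))) (ξ : E) :
    ‖ξ‖ * ‖invLaplacianDivSymbol f ξ‖ ≤ ∑ j, ‖𝓕 (schwartzComponent f j) ξ‖ := by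
  have h1 : ‖𝓕 (schwartzDivergence f) ξ‖ ≤
      2 * Real.pi * ‖ξ‖ * ∑ j, ‖𝓕 (schwartzComponent f j) ξ‖ := by
    rw [fourier_schwartzDivergence, Finset.mul_sum]
    refine norm_sum_le_of_le _ fun j _ => ?_
    have := PiLp.norm_apply_le ξ j
    simp only [norm_mul, Complex.norm_real, Complex.norm_I, Complex.norm_ofNat,
      Real.norm_of_nonneg Real.pi_pos.le, mul_one]
    rw [mul_assoc (2 * Real.pi)]
    gcongr
  rcases eq_or_ne ξ 0 with rfl | hξ
  · simp only [norm_zero, zero_mul]; positivity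
  have hξ' : 0 < ‖ξ‖ := norm_pos_iff.2 hξ
  have hS : 0 ≤ ∑ j, ‖𝓕 (schwartzComponent f j) ξ‖ := by positivity
  rw [invLaplacianDivSymbol, norm_mul, norm_inv, Complex.norm_real,
    Real.norm_of_nonneg (by positivity)]
  calc ‖ξ‖ * (((2 * Real.pi * ‖ξ‖) ^ 2)⁻¹ * ‖𝓕 (schwartzDivergence f) ξ‖)
      ≤ ‖ξ‖ * (((2 * Real.pi * ‖ξ‖) ^ 2)⁻¹ *
        (2 * Real.pi * ‖ξ‖ * ∑ j, ‖𝓕 (schwartzComponent f j) ξ‖)) := by gcongr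
    _ = (2 * Real.pi)⁻¹ * ∑ j, ‖𝓕 (schwartzComponent f j) ξ‖ := by field_simp
    _ ≤ 1 * ∑ j, ‖𝓕 (schwartzComponent f j) ξ‖ := by
      gcongr
      exact inv_le_one_of_one_le₀ (by linarith [Real.pi_gt_three])
    _ = _ := one_mul _

theorem integrable_norm_mul_invLaplacianDivSymbol (f : 𝓢(E, EuclideanSpace ℂ (Fin N))) :
    Integrable fun ξ : E => ‖ξ‖ * ‖invLaplacianDivSymbol f ξ‖ := by
  refine Integrable.mono' (g := fun ξ => ∑ j, ‖𝓕 (schwartzComponent f j) ξ‖)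
    (integrable_finsetSum _ fun j _ => (𝓕 (schwartzComponent f j)).integrable.norm)
    (continuous_norm.aestronglyMeasurable.mul
      (aestronglyMeasurable_invLaplacianDivSymbol f).norm) (.of_forall fun ξ => ?_)
  rw [Real.norm_of_nonneg (by positivity)]
  exact norm_mul_norm_invLaplacianDivSymbol_le f ξ

theorem integrable_norm_sq_mul_invLaplacianDivSymbol (f : 𝓢(E, EuclideanSpace ℂ (Fin N))) :
    Integrable fun ξ : E => ‖ξ‖ ^ 2 * ‖invLaplacianDivSymbol f ξ‖ := by
  refine Integrable.mono' (g := fun ξ => ∑ j, ‖ξ‖ ^ 1 * ‖𝓕 (schwartzComponent f j) ξ‖)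
    (integrable_finsetSum _ fun j _ => (𝓕 (schwartzComponent f j)).integrable_pow_mul _ 1)
    ((continuous_norm.pow 2).aestronglyMeasurable.mul
      (aestronglyMeasurable_invLaplacianDivSymbol f).norm) (.of_forall fun ξ => ?_)
  rw [Real.norm_of_nonneg (by positivity), ← Finset.mul_sum, pow_one, sq, mul_assoc]
  gcongr
  exact norm_mul_norm_invLaplacianDivSymbol_le f ξ

/-- Near the origin |ξ|⁻¹ is integrable because N ≥ 2; outside the unit ball the extra factor |ξ| in
the previous bounds is at least 1. -/
theorem integrable_invLaplacianDivSymbol (hN : 2 ≤ N) (f : 𝓢(E, EuclideanSpace ℂ (Fin N))) :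
    Integrable (invLaplacianDivSymbol f) := by
  have hmeas := aestronglyMeasurable_invLaplacianDivSymbol f
  rw [← integrableOn_univ, ← Set.union_compl_self (Metric.ball (0 : E) 1), integrableOn_union]
  constructor
  · have hB : ∀ j, ∃ C, ∀ ξ, ‖𝓕 (schwartzComponent f j) ξ‖ ≤ C := fun j => by
      obtain ⟨C, hC⟩ := (𝓕 (schwartzComponent f j)).decay 0 0
      exact ⟨C, fun ξ => by simpa using hC.2 ξ⟩
    choose B hB using hB
    refine integrableOn_ball_of_norm_le_rpow (C := ∑ j, B j) (α := 1) ?_ ?_ (.of_forall ?_) hmeas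
    · rw [finrank_euclideanSpace_fin]; omega
    · rw [finrank_euclideanSpace_fin]; exact_mod_cast hN
    · intro ξ
      have hB0 : 0 ≤ ∑ j, B j := Finset.sum_nonneg fun j _ => (norm_nonneg _).trans (hB j 0)
      rcases eq_or_ne ξ 0 with rfl | hξ
      -- At ξ = 0 the convention that the inverse of 0 is 0 makes the symbol vanish.
      · simp only [invLaplacianDivSymbol, norm_zero]
        simp
      · rw [Real.rpow_neg_one, ← div_eq_mul_inv, le_div_iff₀' (norm_pos_iff.2 hξ)]
        exact (norm_mul_norm_invLaplacianDivSymbol_le f ξ).trans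
          (Finset.sum_le_sum fun j _ => hB j ξ)
  · refine Integrable.mono' (integrable_norm_mul_invLaplacianDivSymbol f).integrableOn
      hmeas.restrict ?_
    filter_upwards [ae_restrict_mem measurableSet_ball.compl] with ξ hξ
    have : 1 ≤ ‖ξ‖ := by simpa using hξ
    exact le_mul_of_one_le_left (norm_nonneg _) this

theorem gradInvLaplacianDiv_apply (hN : 2 ≤ N) (f : 𝓢(E, EuclideanSpace ℂ (Fin N))) (x : E)
    (j : Fin N) : gradInvLaplacianDiv f x j =
      𝓕⁻ (fun ξ => 2 * Real.pi * Complex.I * (ξ j * invLaplacianDivSymbol f ξ)) x := by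
  simp only [gradInvLaplacianDiv, complexGradient]
  rw [invNegLaplacian_divergence, fderiv_fourierInv_apply
    (integrable_invLaplacianDivSymbol hN f) (integrable_norm_mul_invLaplacianDivSymbol f)]
  simp [EuclideanSpace.inner_single_right]

theorem contDiff_gradInvLaplacianDiv (hN : 2 ≤ N) (f : 𝓢(E, EuclideanSpace ℂ (Fin N))) :
    ContDiff ℝ 1 (gradInvLaplacianDiv f) := by
  have h : ContDiff ℝ 2 (invNegLaplacian (divergence f)) := by
    rw [invNegLaplacian_divergence]
    refine contDiff_fourierInv (n := 2) fun k hk => ?_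
    have : k ≤ 2 := by exact_mod_cast hk
    interval_cases k
    · simpa using (integrable_invLaplacianDivSymbol hN f).norm
    · simpa using integrable_norm_mul_invLaplacianDivSymbol f
    · exact integrable_norm_sq_mul_invLaplacianDivSymbol f
  refine (contDiff_piLp 2).2 fun j => ?_
  exact (h.fderiv_right (m := 1) (by norm_num)).clm_apply contDiff_const

theorem fderiv_gradInvLaplacianDiv_apply (hN : 2 ≤ N) (f : 𝓢(E, EuclideanSpace ℂ (Fin N)))
    (x : E) (j k : Fin N) :
    (fderiv ℝ (gradInvLaplacianDiv f) x (EuclideanSpace.single k 1)) j =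
      𝓕⁻ (fun ξ : E => -(4 * Real.pi ^ 2 : ℂ) * (ξ j * ξ k * invLaplacianDivSymbol f ξ)) x := by
  rw [fderiv_euclidean_apply ((contDiff_gradInvLaplacianDiv hN f).differentiable one_ne_zero _)]
  simp only [gradInvLaplacianDiv_apply hN]
  have hm := aestronglyMeasurable_invLaplacianDivSymbol f
  have hmj : AEStronglyMeasurable
      fun ξ : E => 2 * Real.pi * Complex.I * (ξ j * invLaplacianDivSymbol f ξ) := by
    have : Continuous fun ξ : E => (ξ j : ℂ) := by fun_prop
    exact (this.aestronglyMeasurable.mul hm).const_mul _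
  have hb : ∀ ξ : E, ‖2 * Real.pi * Complex.I * (ξ j * invLaplacianDivSymbol f ξ)‖ ≤
      2 * Real.pi * (‖ξ‖ * ‖invLaplacianDivSymbol f ξ‖) := fun ξ => by
    have := PiLp.norm_apply_le ξ j
    simp only [norm_mul, Complex.norm_real, Complex.norm_I, Complex.norm_ofNat,
      Real.norm_of_nonneg Real.pi_pos.le, mul_one]
    gcongr
  have h1 : Integrable fun ξ : E =>
      2 * Real.pi * Complex.I * (ξ j * invLaplacianDivSymbol f ξ) :=
    ((integrable_norm_mul_invLaplacianDivSymbol f).const_mul (2 * Real.pi)).mono' hmj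
      (.of_forall hb)
  have h2 : Integrable fun ξ : E =>
      ‖ξ‖ * ‖2 * Real.pi * Complex.I * (ξ j * invLaplacianDivSymbol f ξ)‖ := by
    refine ((integrable_norm_sq_mul_invLaplacianDivSymbol f).const_mul (2 * Real.pi)).mono'
      (continuous_norm.aestronglyMeasurable.mul hmj.norm) (.of_forall fun ξ => ?_)
    rw [Real.norm_of_nonneg (by positivity)]
    calc _ ≤ ‖ξ‖ * (2 * Real.pi * (‖ξ‖ * ‖invLaplacianDivSymbol f ξ‖)) := by
          gcongr; exact hb ξ
      _ = _ := by ring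
  have := fderiv_fourierInv_apply h1 h2 x (EuclideanSpace.single k 1)
  rw [this]
  refine congrFun (congrArg 𝓕⁻ (funext fun ξ => ?_)) x
  simp only [EuclideanSpace.inner_single_right, one_mul]
  simp only [conj_trivial]
  linear_combination (4 * (Real.pi : ℂ) ^ 2 * (ξ j * ξ k * invLaplacianDivSymbol f ξ)) *
    Complex.I_sq

/-- The field is a gradient: its first derivatives have the multiplier ξ_j ξ_k, symmetric in j and
k. -/
theorem fderiv_gradInvLaplacianDiv_symm (hN : 2 ≤ N) (f : 𝓢(E, EuclideanSpace ℂ (Fin N)))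
    (x : E) (j k : Fin N) :
    (fderiv ℝ (gradInvLaplacianDiv f) x (EuclideanSpace.single k 1)) j =
      (fderiv ℝ (gradInvLaplacianDiv f) x (EuclideanSpace.single j 1)) k := by
  rw [fderiv_gradInvLaplacianDiv_apply hN, fderiv_gradInvLaplacianDiv_apply hN]
  simp only [mul_comm]

/-- Summing the diagonal multipliers gives -4π²|ξ|², which cancels the symbol of (-Δ)⁻¹ up to sign.
At ξ = 0, where the cancellation fails, the transform of div f vanishes anyway. -/
theorem divergence_gradInvLaplacianDiv (hN : 2 ≤ N) (f : 𝓢(E, EuclideanSpace ℂ (Fin N)))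
    (x : E) : divergence (gradInvLaplacianDiv f) x = -divergence f x := by
  have hm := aestronglyMeasurable_invLaplacianDivSymbol f
  have hint : ∀ j : Fin N, Integrable fun ξ : E =>
      -(4 * Real.pi ^ 2 : ℂ) * (ξ j * ξ j * invLaplacianDivSymbol f ξ) := fun j => by
    have hc : Continuous fun ξ : E => (ξ j * ξ j : ℂ) := by fun_prop
    refine Integrable.const_mul ?_ _
    refine (integrable_norm_sq_mul_invLaplacianDivSymbol f).mono'
      (hc.aestronglyMeasurable.mul hm) (.of_forall fun ξ => ?_)
    have := PiLp.norm_apply_le ξ j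
    simp only [norm_mul, Complex.norm_real, sq]
    gcongr
  have hD : -divergence f x = 𝓕⁻ (fun ξ => -𝓕 (schwartzDivergence f) ξ) x := by
    rw [← coe_schwartzDivergence]
    conv_lhs => rw [← FourierTransform.fourierInv_fourier_eq (F := 𝓢(E, ℂ)) (schwartzDivergence f),
      SchwartzMap.fourierInv_coe]
    simp only [Real.fourierInv_eq, smul_neg, integral_neg]
  rw [hD]
  simp only [divergence, fderiv_gradInvLaplacianDiv_apply hN, Real.fourierInv_eq]
  rw [← integral_finsetSum _ fun j _ => ?_]
  · congr 1 with ξ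
    rw [← Finset.smul_sum, ← Finset.mul_sum, ← Finset.sum_mul]
    congr 1
    have hn : ∑ j, (ξ j * ξ j : ℂ) = ((‖ξ‖ ^ 2 : ℝ) : ℂ) := by
      rw [EuclideanSpace.norm_sq_eq]
      push_cast
      refine Finset.sum_congr rfl fun j _ => ?_
      rw [← Complex.ofReal_pow, Real.norm_eq_abs, sq_abs]
      push_cast; ring
    rw [hn, invLaplacianDivSymbol]
    rcases eq_or_ne ξ 0 with rfl | hξ
    · rw [fourier_schwartzDivergence]; simp
    · have : (‖ξ‖ : ℂ) ≠ 0 := by simpa using hξ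
      have : (Real.pi : ℂ) ≠ 0 := by simp [Real.pi_ne_zero]
      push_cast
      field_simp
      ring
  · simpa using (Real.fourierIntegral_convergent_iff (V := E) (-x)).2 (hint j)

end Divergence

/-! ### Integration by parts: the cutoff mass is controlled where the cutoff varies. -/

section RingEstimates

variable {N : ℕ}

local notation "E" => EuclideanSpace ℝ (Fin N)

theorem integral_smul_fderiv_eq_neg {ψ : E → ℝ} (hψ : ContDiff ℝ 1 ψ) (hc : HasCompactSupport ψ)
    {p : E → ℂ} (hp : ContDiff ℝ 1 p) (v : E) :
    ∫ y, ψ y • fderiv ℝ p y v = -∫ y, fderiv ℝ ψ y v • p y := by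
  have hψ' : Continuous fun y => fderiv ℝ ψ y v :=
    (hψ.continuous_fderiv one_ne_zero).clm_apply continuous_const
  have hp' : Continuous fun y => fderiv ℝ p y v :=
    (hp.continuous_fderiv one_ne_zero).clm_apply continuous_const
  refine integral_smul_fderiv_eq_neg_fderiv_smul_of_integrable ?_ ?_ ?_
    (fun x _ => hψ.differentiable one_ne_zero x) (fun x _ => hp.differentiable one_ne_zero x)
  · exact (hψ'.smul hp.continuous).integrable_of_hasCompactSupport (hc.fderiv_apply ℝ v).smul_right
  · exact (hψ.continuous.smul hp').integrable_of_hasCompactSupport hc.smul_right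
  · exact (hψ.continuous.smul hp.continuous).integrable_of_hasCompactSupport hc.smul_right

theorem fderiv_coord_mul_apply {φ : E → ℝ} (hφ : ContDiff ℝ 1 φ) (i k : Fin N) (y : E) :
    fderiv ℝ (fun z : E => z i * φ z) y (EuclideanSpace.single k 1) =
      (if i = k then φ y else 0) + y i * fderiv ℝ φ y (EuclideanSpace.single k 1) := by
  have h1 : HasFDerivAt (fun z : E => z i) (EuclideanSpace.proj i : E →L[ℝ] ℝ) y :=
    (EuclideanSpace.proj i : E →L[ℝ] ℝ).hasFDerivAt
  have h2 : HasFDerivAt (fun z : E => z i * φ z) _ y := h1.mul (hφ.differentiable one_ne_zero y).hasFDerivAt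
  rw [h2.fderiv]
  have h3 : (EuclideanSpace.proj i : E →L[ℝ] ℝ) (EuclideanSpace.single k 1) =
      if i = k then 1 else 0 := PiLp.single_apply (p := 2) ..
  simp only [add_apply, smul_apply, smul_eq_mul, h3]
  split_ifs <;> ring

theorem enorm_coord_mul_fderiv_smul_le {φ : E → ℝ} (w : E → EuclideanSpace ℂ (Fin N))
    (i k j : Fin N) (y : E) :
    ‖(y i * fderiv ℝ φ y (EuclideanSpace.single k 1)) • w y j‖ₑ ≤
      ENNReal.ofReal (‖y‖ * ‖fderiv ℝ φ y‖) * ‖w y‖ₑ := by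
  rw [← ofReal_norm, ← ofReal_norm, ← ENNReal.ofReal_mul (by positivity)]
  refine ENNReal.ofReal_le_ofReal ?_
  rw [norm_smul, norm_mul]
  have h1 := PiLp.norm_apply_le y i
  have h2 := PiLp.norm_apply_le (w y) j
  have h3 : ‖fderiv ℝ φ y (EuclideanSpace.single k 1)‖ ≤ ‖fderiv ℝ φ y‖ := by
    simpa using (fderiv ℝ φ y).le_opNorm (EuclideanSpace.single k 1)
  gcongr

theorem enorm_integral_sum_coord_mul_fderiv_smul_le {φ : E → ℝ}
    (w : E → EuclideanSpace ℂ (Fin N)) (i j k : Fin N → Fin N) :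
    ‖∫ y, ∑ n, (y (i n) * fderiv ℝ φ y (EuclideanSpace.single (k n) 1)) • w y (j n)‖ₑ ≤
      N * ∫⁻ y, ENNReal.ofReal (‖y‖ * ‖fderiv ℝ φ y‖) * ‖w y‖ₑ := by
  refine (enorm_integral_le_lintegral_enorm _).trans ?_
  rw [← lintegral_const_mul' _ _ (by finiteness)]
  refine lintegral_mono fun y => (enorm_sum_le _ _).trans ?_
  refine (Finset.sum_le_sum fun n _ => enorm_coord_mul_fderiv_smul_le w _ _ _ y).trans ?_
  simp

/-- Integration by parts for a divergence-free field against a cutoff function. -/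
theorem integral_smul_eq_of_divergence_eq_zero {φ : E → ℝ} (hφ : ContDiff ℝ 1 φ)
    (hc : HasCompactSupport φ) {w : E → EuclideanSpace ℂ (Fin N)} (hw : ContDiff ℝ 1 w)
    (hdiv : ∀ y, divergence w y = 0) (j : Fin N) :
    ∫ y, φ y • w y j =
      -∫ y, ∑ k, (y j * fderiv ℝ φ y (EuclideanSpace.single k 1)) • w y k := by
  have hwk : ∀ k, ContDiff ℝ 1 fun y => w y k := (contDiff_piLp 2).1 hw
  have hψ : ContDiff ℝ 1 fun y : E => y j * φ y := by fun_prop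
  have hcψ : HasCompactSupport fun y : E => y j * φ y := hc.mul_left
  have hDφ : ∀ k, Continuous fun y => fderiv ℝ φ y (EuclideanSpace.single k 1) := fun k =>
    (hφ.continuous_fderiv one_ne_zero).clm_apply continuous_const
  have hyj : Continuous fun y : E => y j := by fun_prop
  -- Test div w = 0 against y_j φ. Since ∂_k(y_j φ) = δ_jk φ + y_j ∂_k φ, the Kronecker term
  -- isolates ∫ φ w_j.
  have h1 : ∑ k, ∫ y, (y j * φ y) • fderiv ℝ (fun z => w z k) y (EuclideanSpace.single k 1) = 0 := by
    rw [← integral_finsetSum]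
    · simp only [← Finset.smul_sum]
      convert! integral_zero E ℂ with y
      convert! smul_zero _
      rw [← hdiv y]
      exact Finset.sum_congr rfl fun k _ =>
        (fderiv_euclidean_apply (hw.differentiable one_ne_zero y) _ k).symm
    · intro k _
      exact (hψ.continuous.smul (((hwk k).continuous_fderiv one_ne_zero).clm_apply
        continuous_const)).integrable_of_hasCompactSupport hcψ.smul_right
  simp only [fun k => integral_smul_fderiv_eq_neg hψ hcψ (hwk k) (EuclideanSpace.single k 1),
    fderiv_coord_mul_apply hφ, Finset.sum_neg_distrib, neg_eq_zero, add_smul] at h1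
  have hi1 : ∀ k, Integrable fun y => (if j = k then φ y else 0) • w y k := fun k => by
    split_ifs
    · exact (hφ.continuous.smul (hwk k).continuous).integrable_of_hasCompactSupport hc.smul_right
    · simp
  have hi2 : ∀ k, Integrable fun y : E =>
      (y j * fderiv ℝ φ y (EuclideanSpace.single k 1)) • w y k := fun k =>
    ((hyj.mul (hDφ k)).smul (hwk k).continuous).integrable_of_hasCompactSupport
      (hc.fderiv_apply ℝ _).mul_left.smul_right
  simp only [fun k => integral_add (hi1 k) (hi2 k), Finset.sum_add_distrib] at h1
  rw [← integral_finsetSum _ fun k _ => hi2 k] at h1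
  rw [Finset.sum_eq_single j (fun k _ hk => by simp [hk.symm]) (by simp)] at h1
  simpa using eq_neg_of_add_eq_zero_left h1

/-- Integration by parts for a curl-free field against a cutoff function. -/
theorem integral_smul_eq_of_curl_eq_zero {φ : E → ℝ} (hφ : ContDiff ℝ 1 φ)
    (hc : HasCompactSupport φ) {g : E → EuclideanSpace ℂ (Fin N)} (hg : ContDiff ℝ 1 g)
    (hcurl : ∀ y j k, (fderiv ℝ g y (EuclideanSpace.single k 1)) j =
      (fderiv ℝ g y (EuclideanSpace.single j 1)) k) (j : Fin N) :
    ((N : ℝ) - 1) • ∫ y, φ y • g y j =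
      (∫ y, ∑ k, (y k * fderiv ℝ φ y (EuclideanSpace.single j 1)) • g y k) -
        ∫ y, ∑ k, (y k * fderiv ℝ φ y (EuclideanSpace.single k 1)) • g y j := by
  have hgk : ∀ k, ContDiff ℝ 1 fun y => g y k := (contDiff_piLp 2).1 hg
  have hψ : ∀ k, ContDiff ℝ 1 fun y : E => y k * φ y := fun k => by fun_prop
  have hcψ : ∀ k, HasCompactSupport fun y : E => y k * φ y := fun k => hc.mul_left
  have hDφ : ∀ k, Continuous fun y => fderiv ℝ φ y (EuclideanSpace.single k 1) := fun k =>
    (hφ.continuous_fderiv one_ne_zero).clm_apply continuous_const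
  have hyk : ∀ k, Continuous fun y : E => y k := fun k => by fun_prop
  have hi : ∀ k, Integrable fun y => φ y • g y k := fun k =>
    (hφ.continuous.smul (hgk k).continuous).integrable_of_hasCompactSupport hc.smul_right
  have hi2 : ∀ k m n, Integrable fun y : E =>
      (y k * fderiv ℝ φ y (EuclideanSpace.single m 1)) • g y n := fun k m n =>
    (((hyk k).mul (hDφ m)).smul (hgk n).continuous).integrable_of_hasCompactSupport
      (hc.fderiv_apply ℝ _).mul_left.smul_right
  -- Test ∂_k g_j = ∂_j g_k against y_k φ. Summing over k, ∫ φ g_j occurs N times on the left and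
  -- once on the right, whence the factor N - 1.
  have h1 : ∀ k, (∫ y, φ y • g y j) +
      ∫ y, (y k * fderiv ℝ φ y (EuclideanSpace.single k 1)) • g y j =
      (if k = j then ∫ y, φ y • g y j else 0) +
        ∫ y, (y k * fderiv ℝ φ y (EuclideanSpace.single j 1)) • g y k := fun k => by
    have h2 := integral_smul_fderiv_eq_neg (hψ k) (hcψ k) (hgk j) (EuclideanSpace.single k 1)
    have h3 := integral_smul_fderiv_eq_neg (hψ k) (hcψ k) (hgk k) (EuclideanSpace.single j 1)
    simp only [← fderiv_euclidean_apply (hg.differentiable one_ne_zero _)] at h2 h3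
    simp only [hcurl _ j k] at h2
    have h4 := neg_injective (h2.symm.trans h3)
    simp only [fderiv_coord_mul_apply hφ, add_smul, if_true] at h4
    rw [integral_add (hi j) (hi2 k k j)] at h4
    rw [h4]
    by_cases hkj : k = j
    · subst hkj
      simp only [if_true]
      rw [integral_add (hi k) (hi2 k k k)]
    · simp [hkj]
  have h5 := Finset.sum_congr rfl fun k (_ : k ∈ Finset.univ) => h1 k
  simp only [Finset.sum_add_distrib, Finset.sum_const, Finset.card_univ, Fintype.card_fin,
    Finset.sum_ite_eq', Finset.mem_univ, if_true] at h5
  rw [integral_finsetSum _ fun k _ => hi2 k j k, integral_finsetSum _ fun k _ => hi2 k k j,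
    sub_smul, one_smul, sub_eq_sub_iff_add_eq_add]
  rw [Nat.cast_smul_eq_nsmul ℝ N]
  rw [h5, add_comm]

/-- Write f = (f + g) - g and treat the divergence-free and the curl-free field separately. Only
derivatives of φ survive, and N ≥ 2 allows the factor N - 1 ≥ 1 of the curl identity to be dropped.
-/
theorem enorm_integral_cutoff_smul_le (hN : 2 ≤ N) {φ : E → ℝ} (hφ : ContDiff ℝ 1 φ)
    (hc : HasCompactSupport φ) {f g : E → EuclideanSpace ℂ (Fin N)} (hf : ContDiff ℝ 1 f)
    (hg : ContDiff ℝ 1 g) (hdiv : ∀ y, divergence g y = -divergence f y)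
    (hcurl : ∀ y j k, (fderiv ℝ g y (EuclideanSpace.single k 1)) j =
      (fderiv ℝ g y (EuclideanSpace.single j 1)) k) :
    ‖∫ y, φ y • f y‖ₑ ≤
      3 * N ^ 2 * ∫⁻ y, ENNReal.ofReal (‖y‖ * ‖fderiv ℝ φ y‖) * (‖f y‖ₑ + ‖g y‖ₑ) := by
  set T := ∫⁻ y, ENNReal.ofReal (‖y‖ * ‖fderiv ℝ φ y‖) * (‖f y‖ₑ + ‖g y‖ₑ) with hT
  have hdivw : ∀ y, divergence (fun z => f z + g z) y = 0 := fun y => by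
    have h := hdiv y
    simp only [divergence] at h ⊢
    simp only [fderiv_fun_add (hf.differentiable one_ne_zero y) (hg.differentiable one_ne_zero y),
      add_apply, PiLp.add_apply, Finset.sum_add_distrib, h, add_neg_cancel]
  have hfk : ∀ k, Continuous fun y => f y k := fun k => ((contDiff_piLp 2).1 hf k).continuous
  have hgk : ∀ k, Continuous fun y => g y k := fun k => ((contDiff_piLp 2).1 hg k).continuous
  have hif : ∀ k, Integrable fun y => φ y • f y k := fun k =>
    (hφ.continuous.smul (hfk k)).integrable_of_hasCompactSupport hc.smul_right
  have hig : ∀ k, Integrable fun y => φ y • g y k := fun k =>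
    (hφ.continuous.smul (hgk k)).integrable_of_hasCompactSupport hc.smul_right
  have hw : ∀ j, ‖∫ y, φ y • (f y + g y) j‖ₑ ≤ N * T := fun j => by
    rw [integral_smul_eq_of_divergence_eq_zero hφ hc (hf.add hg) hdivw j, enorm_neg]
    refine (enorm_integral_sum_coord_mul_fderiv_smul_le (fun y => f y + g y)
      (fun _ => j) id id).trans ?_
    refine mul_le_mul_right (lintegral_mono fun y => ?_) _
    exact mul_le_mul_right (enorm_add_le _ _) _
  have hTg : ∫⁻ y, ENNReal.ofReal (‖y‖ * ‖fderiv ℝ φ y‖) * ‖g y‖ₑ ≤ T := by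
    refine lintegral_mono fun y => ?_
    gcongr
    exact le_add_self
  have hgj : ∀ j, ‖∫ y, φ y • g y j‖ₑ ≤ 2 * N * T := fun j => by
    have h1 : ‖∫ y, φ y • g y j‖ₑ ≤ ‖((N : ℝ) - 1) • ∫ y, φ y • g y j‖ₑ := by
      rw [← ofReal_norm, ← ofReal_norm, norm_smul]
      refine ENNReal.ofReal_le_ofReal (le_mul_of_one_le_left (norm_nonneg _) ?_)
      have : (2 : ℝ) ≤ N := by exact_mod_cast hN
      rw [Real.norm_of_nonneg (by linarith)]
      linarith
    refine h1.trans ?_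
    rw [integral_smul_eq_of_curl_eq_zero hφ hc hg hcurl j]
    refine (enorm_sub_le).trans ?_
    have h2 := enorm_integral_sum_coord_mul_fderiv_smul_le (φ := φ) g id id (fun _ => j)
    have h3 := enorm_integral_sum_coord_mul_fderiv_smul_le (φ := φ) g id (fun _ => j) id
    refine (add_le_add h2 h3).trans ?_
    rw [← two_mul, ← mul_assoc]
    gcongr
  have hfj : ∀ j, ‖∫ y, φ y • f y j‖ₑ ≤ 3 * N * T := fun j => by
    have h1 : ∫ y, φ y • f y j = (∫ y, φ y • (f y + g y) j) - ∫ y, φ y • g y j := by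
      rw [← integral_sub]
      · simp
      · exact ((hif j).add (hig j)).congr (.of_forall fun y => (smul_add _ _ _).symm)
      · exact hig j
    rw [h1]
    refine (enorm_sub_le).trans ((add_le_add (hw j) (hgj j)).trans (le_of_eq ?_))
    ring
  have hcomp : ∀ j, (∫ y, φ y • f y) j = ∫ y, φ y • f y j := fun j => by
    have hi : Integrable fun y => φ y • f y :=
      (hφ.continuous.smul hf.continuous).integrable_of_hasCompactSupport hc.smul_right
    exact (((EuclideanSpace.proj j : EuclideanSpace ℂ (Fin N) →L[ℂ] ℂ).restrictScalars
      ℝ).integral_comp_comm hi).symm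
  have hsum : ∫ y, φ y • f y = ∑ j, EuclideanSpace.single j ((∫ y, φ y • f y) j) := by
    ext k
    simp
  rw [hsum]
  refine (enorm_sum_le _ _).trans ?_
  calc ∑ j, ‖EuclideanSpace.single j ((∫ y, φ y • f y) j)‖ₑ ≤ ∑ _j : Fin N, 3 * N * T := by
        refine Finset.sum_le_sum fun j _ => ?_
        rw [← ofReal_norm, PiLp.norm_single, ofReal_norm, hcomp]
        exact hfj j
    _ = 3 * N ^ 2 * T := by
        simp; ring

end RingEstimates

/-! ### Cutoffs at scale R: the ring estimate, vanishing of the integral, and decay. -/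

section Cutoff

variable {N : ℕ}

local notation "E" => EuclideanSpace ℝ (Fin N)

/-- A smooth bump on `ℝ^N`, equal to `1` on the ball of radius `1/4` and supported in the ball of
radius `1/2`. -/
noncomputable def unitBump (N : ℕ) : ContDiffBump (0 : EuclideanSpace ℝ (Fin N)) where
  rIn := 1 / 4
  rOut := 1 / 2
  rIn_pos := by norm_num
  rIn_lt_rOut := by norm_num

/-- The cutoff function at scale `R`. -/
noncomputable def cutoff (R : ℝ) (y : E) : ℝ := unitBump N (R⁻¹ • y)

theorem contDiff_cutoff (R : ℝ) : ContDiff ℝ 1 (cutoff R : E → ℝ) :=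
  (unitBump N).contDiff.comp (contDiff_const_smul _)

theorem hasCompactSupport_cutoff {R : ℝ} (hR : 0 < R) : HasCompactSupport (cutoff R : E → ℝ) :=
  (unitBump N).hasCompactSupport.comp_smul (inv_ne_zero hR.ne')

theorem cutoff_nonneg (R : ℝ) (y : E) : 0 ≤ cutoff R y := (unitBump N).nonneg

theorem cutoff_le_one (R : ℝ) (y : E) : cutoff R y ≤ 1 := (unitBump N).le_one

theorem norm_inv_smul {R : ℝ} (hR : 0 < R) (y : E) : ‖R⁻¹ • y‖ = ‖y‖ / R := by
  rw [norm_smul, norm_inv, Real.norm_of_nonneg hR.le, inv_mul_eq_div]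

theorem cutoff_eq_one {R : ℝ} (hR : 0 < R) {y : E} (hy : 4 * ‖y‖ ≤ R) : cutoff R y = 1 := by
  refine (unitBump N).one_of_mem_closedBall ?_
  rw [mem_closedBall_zero_iff, norm_inv_smul hR, div_le_iff₀ hR]
  simp only [unitBump]; linarith

theorem cutoff_eq_zero {R : ℝ} (hR : 0 < R) {y : E} (hy : R ≤ 2 * ‖y‖) : cutoff R y = 0 := by
  refine (unitBump N).zero_of_le_dist ?_
  rw [dist_zero_right, norm_inv_smul hR, le_div_iff₀ hR]
  simp only [unitBump]; linarith

/-- The quantity |y| |∇φ_R(y)| is scale invariant: the derivative costs R⁻¹ and |y| ≤ R on the ring.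
Off the ring the cutoff is locally constant. -/
theorem exists_norm_mul_norm_fderiv_cutoff_le (N : ℕ) : ∃ C : ℝ, 0 ≤ C ∧ ∀ R : ℝ, 0 < R →
    ∀ y : EuclideanSpace ℝ (Fin N), ‖y‖ * ‖fderiv ℝ (cutoff R) y‖ ≤
      {y : EuclideanSpace ℝ (Fin N) | R ≤ 4 * ‖y‖ ∧ 2 * ‖y‖ ≤ R}.indicator (fun _ => C) y := by
  have hcont : Continuous fun y : EuclideanSpace ℝ (Fin N) => fderiv ℝ (unitBump N) y :=
    (unitBump N).contDiff.continuous_fderiv (n := 1) one_ne_zero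
  obtain ⟨C, hC⟩ := ((unitBump N).hasCompactSupport.fderiv ℝ).exists_bound_of_continuous hcont
  have hC0 : 0 ≤ C := (norm_nonneg _).trans (hC 0)
  refine ⟨C, hC0, fun R hR y => ?_⟩
  by_cases hy : y ∈ {y : EuclideanSpace ℝ (Fin N) | R ≤ 4 * ‖y‖ ∧ 2 * ‖y‖ ≤ R}
  · rw [Set.indicator_of_mem hy]
    have h1 : ‖fderiv ℝ (cutoff R) y‖ ≤ R⁻¹ * C := by
      have h2 : HasFDerivAt (unitBump N) (fderiv ℝ (unitBump N) (R⁻¹ • y)) (R⁻¹ • y) :=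
        ((unitBump N).contDiff.differentiable (n := 1) one_ne_zero _).hasFDerivAt
      have h3 : HasFDerivAt (cutoff R) _ y :=
        h2.comp y ((hasFDerivAt_id y).const_smul R⁻¹)
      rw [h3.fderiv, ContinuousLinearMap.comp_smul, norm_smul, norm_inv,
        Real.norm_of_nonneg hR.le, ContinuousLinearMap.comp_id]
      gcongr
      exact hC _
    have h4 : ‖y‖ ≤ R := by linarith [hy.2, norm_nonneg y]
    calc ‖y‖ * ‖fderiv ℝ (cutoff R) y‖ ≤ R * (R⁻¹ * C) := by gcongr
      _ = C := by field_simp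
  · rw [Set.indicator_of_notMem hy]
    refine le_of_eq (mul_eq_zero_of_right _ (norm_eq_zero.2 ?_))
    rcases not_and_or.1 hy with h | h
    · have : cutoff R =ᶠ[nhds y] fun _ => (1 : ℝ) := by
        filter_upwards [(isOpen_lt (continuous_const.mul continuous_norm)
          continuous_const).mem_nhds (not_le.1 h)] with z hz
        exact cutoff_eq_one hR (le_of_lt hz)
      rw [this.fderiv_eq, fderiv_fun_const]; rfl
    · have : cutoff R =ᶠ[nhds y] fun _ => (0 : ℝ) := by
        filter_upwards [(isOpen_lt continuous_const (continuous_const.mul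
          continuous_norm)).mem_nhds (not_le.1 h)] with z hz
        exact cutoff_eq_zero hR (le_of_lt hz)
      rw [this.fderiv_eq, fderiv_fun_const]; rfl

/-- `g` is a `C^1` curl-free field with `div (f + g) = 0`. -/
structure IsGradientCorrection (f g : E → EuclideanSpace ℂ (Fin N)) : Prop where
  contDiff_left : ContDiff ℝ 1 f
  contDiff_right : ContDiff ℝ 1 g
  divergence_eq : ∀ y, divergence g y = -divergence f y
  curl_eq : ∀ y j k, (fderiv ℝ g y (EuclideanSpace.single k 1)) j =
      (fderiv ℝ g y (EuclideanSpace.single j 1)) k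

theorem isGradientCorrection_gradInvLaplacianDiv (hN : 2 ≤ N)
    (f : 𝓢(E, EuclideanSpace ℂ (Fin N))) : IsGradientCorrection f (gradInvLaplacianDiv f) where
  contDiff_left := f.smooth 1
  contDiff_right := contDiff_gradInvLaplacianDiv hN f
  divergence_eq := divergence_gradInvLaplacianDiv hN f
  curl_eq := fderiv_gradInvLaplacianDiv_symm hN f

theorem measurableSet_ring (R : ℝ) : MeasurableSet {y : E | R ≤ 4 * ‖y‖ ∧ 2 * ‖y‖ ≤ R} := by
  have h1 : MeasurableSet {y : E | R ≤ 4 * ‖y‖} := measurableSet_le measurable_const (by fun_prop)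
  have h2 : MeasurableSet {y : E | 2 * ‖y‖ ≤ R} := measurableSet_le (by fun_prop) measurable_const
  exact h1.inter h2

theorem exists_enorm_integral_cutoff_smul_le (hN : 2 ≤ N) : ∃ C : ℝ≥0∞, C ≠ ∞ ∧
    ∀ f g : E → EuclideanSpace ℂ (Fin N), IsGradientCorrection f g → ∀ R : ℝ, 0 < R →
      ‖∫ y, cutoff R y • f y‖ₑ ≤
        C * ∫⁻ y in {y : E | R ≤ 4 * ‖y‖ ∧ 2 * ‖y‖ ≤ R}, (‖f y‖ₑ + ‖g y‖ₑ) := by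
  obtain ⟨C, hC0, hC⟩ := exists_norm_mul_norm_fderiv_cutoff_le N
  refine ⟨3 * N ^ 2 * ENNReal.ofReal C, by finiteness, fun f g h R hR => ?_⟩
  refine (enorm_integral_cutoff_smul_le hN (contDiff_cutoff R) (hasCompactSupport_cutoff hR)
    h.contDiff_left h.contDiff_right h.divergence_eq h.curl_eq).trans ?_
  rw [mul_assoc (3 * N ^ 2 : ℝ≥0∞)]
  gcongr 3 * N ^ 2 * ?_
  rw [← lintegral_const_mul' _ _ (by finiteness), ← lintegral_indicator (measurableSet_ring R)]
  refine lintegral_mono fun y => ?_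
  refine (mul_le_mul_left (ENNReal.ofReal_le_ofReal (hC R hR y)) _).trans ?_
  by_cases hy : y ∈ {y : E | R ≤ 4 * ‖y‖ ∧ 2 * ‖y‖ ≤ R}
  · simp only [Set.indicator_of_mem hy, le_refl]
  · simp only [Set.indicator_of_notMem hy, ENNReal.ofReal_zero, zero_mul, le_refl]

/-- As R → ∞ the cutoff integrals tend to ∫ f, while the ring bound is dominated by the tail of the
integrable function |y|^α (|f| + |g|). -/
theorem integral_eq_zero_of_lintegral_ne_top (hN : 2 ≤ N) {f g : E → EuclideanSpace ℂ (Fin N)}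
    (h : IsGradientCorrection f g) (hf : Integrable f) {α : ℝ} (hα : 0 ≤ α)
    (ha : ∫⁻ y, ENNReal.ofReal (‖y‖ ^ α) * ‖f y‖ₑ ≠ ∞)
    (hb : ∫⁻ y, ENNReal.ofReal (‖y‖ ^ α) * ‖g y‖ₑ ≠ ∞) : ∫ y, f y = 0 := by
  obtain ⟨C, hC, hle⟩ := exists_enorm_integral_cutoff_smul_le hN
  have hmeas : Measurable fun y : E => ENNReal.ofReal (‖y‖ ^ α) :=
    (measurable_norm.pow_const α).ennreal_ofReal
  have hfm := h.contDiff_left.continuous.enorm.measurable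
  have hgm := h.contDiff_right.continuous.enorm.measurable
  set H : E → ℝ≥0∞ := fun y => ENNReal.ofReal (‖y‖ ^ α) * (‖f y‖ₑ + ‖g y‖ₑ) with hH
  have hHm : Measurable H := by fun_prop
  have hHfin : ∫⁻ y, H y ≠ ∞ := by
    simp only [hH, mul_add]
    rw [lintegral_add_left (by fun_prop)]
    exact ENNReal.add_ne_top.2 ⟨ha, hb⟩
  have hset : ∀ n : ℕ, MeasurableSet {y : E | (n : ℝ) ≤ 4 * ‖y‖} := fun n =>
    measurableSet_le measurable_const (by fun_prop)
  have htail : Filter.Tendsto (fun n : ℕ => C * ∫⁻ y, {y : E | (n : ℝ) ≤ 4 * ‖y‖}.indicator H y)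
      Filter.atTop (nhds 0) := by
    have h1 : Filter.Tendsto (fun n : ℕ => ∫⁻ y, {y : E | (n : ℝ) ≤ 4 * ‖y‖}.indicator H y)
        Filter.atTop (nhds (∫⁻ _ : E, 0)) := by
      refine tendsto_lintegral_of_dominated_convergence H (fun n => hHm.indicator (hset n))
        (fun n => .of_forall fun y => Set.indicator_le_self _ _ _) hHfin (.of_forall fun y => ?_)
      refine tendsto_const_nhds.congr' ?_
      obtain ⟨n₀, hn₀⟩ := exists_nat_gt (4 * ‖y‖)
      filter_upwards [Filter.eventually_ge_atTop n₀] with n hn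
      refine (Set.indicator_of_notMem ?_ _).symm
      have : (n₀ : ℝ) ≤ n := by exact_mod_cast hn
      exact not_le.2 (hn₀.trans_le this)
    simpa using ENNReal.Tendsto.const_mul h1 (Or.inr hC)
  have hlim : Filter.Tendsto (fun n : ℕ => ∫ y, cutoff (n : ℝ) y • f y) Filter.atTop
      (nhds (∫ y, f y)) := by
    refine tendsto_integral_of_dominated_convergence (fun y => ‖f y‖) (fun n =>
      ((contDiff_cutoff _).continuous.smul h.contDiff_left.continuous).aestronglyMeasurable)
      hf.norm (fun n => .of_forall fun y => ?_) (.of_forall fun y => ?_)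
    · rw [norm_smul, Real.norm_of_nonneg (cutoff_nonneg _ _)]
      exact mul_le_of_le_one_left (norm_nonneg _) (cutoff_le_one _ _)
    · refine tendsto_const_nhds.congr' ?_
      obtain ⟨n₀, hn₀⟩ := exists_nat_gt (4 * ‖y‖)
      filter_upwards [Filter.eventually_ge_atTop n₀] with n hn
      have : (n₀ : ℝ) ≤ n := by exact_mod_cast hn
      rw [cutoff_eq_one (by linarith [norm_nonneg y]) (by linarith), one_smul]
  have hzero : Filter.Tendsto (fun n : ℕ => ‖∫ y, cutoff (n : ℝ) y • f y‖ₑ) Filter.atTop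
      (nhds 0) := by
    refine tendsto_of_tendsto_of_tendsto_of_le_of_le' tendsto_const_nhds htail
      (.of_forall fun _ => zero_le) ?_
    -- For R ≥ 4 the ring lies in |y| ≥ 1, where the weight |y|^α is at least 1.
    filter_upwards [Filter.eventually_ge_atTop 4] with n hn
    have hn' : (4 : ℝ) ≤ n := by exact_mod_cast hn
    refine (hle f g h n (by linarith)).trans ?_
    rw [← lintegral_indicator (measurableSet_ring _)]
    refine mul_le_mul_right (lintegral_mono fun y => ?_) _
    refine Set.indicator_le (fun y hy => ?_) y
    rw [Set.indicator_of_mem (show y ∈ {y : E | (n : ℝ) ≤ 4 * ‖y‖} from hy.1), hH]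
    refine le_mul_of_one_le_left (zero_le) ?_
    rw [← ENNReal.ofReal_one]
    exact ENNReal.ofReal_le_ofReal (Real.one_le_rpow (by linarith [hy.1]) hα)
  simpa using tendsto_nhds_unique hlim.enorm hzero

/-- Since ∫ f = 0, the cutoff φ_R may be replaced by φ_R - 1, which lives on |y| > R/4; there R^α ≤
4^α |y|^α. -/
theorem rpow_mul_enorm_integral_cutoff_smul_le {f : E → EuclideanSpace ℂ (Fin N)}
    (hf : Integrable f) (hf0 : ∫ y, f y = 0) {α : ℝ} (hα : 0 ≤ α) {R : ℝ} (hR : 0 < R) :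
    ENNReal.ofReal (R ^ α) * ‖∫ y, cutoff R y • f y‖ₑ ≤
      ENNReal.ofReal (4 ^ α) * ∫⁻ y, ENNReal.ofReal (‖y‖ ^ α) * ‖f y‖ₑ := by
  have hi : Integrable fun y => cutoff R y • f y :=
    hf.mono ((contDiff_cutoff R).continuous.aestronglyMeasurable.smul hf.1)
      (.of_forall fun y => by
        rw [norm_smul, Real.norm_of_nonneg (cutoff_nonneg _ _)]
        exact mul_le_of_le_one_left (norm_nonneg _) (cutoff_le_one _ _))
  have h1 : ∫ y, cutoff R y • f y = ∫ y, (cutoff R y • f y - f y) := by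
    rw [integral_sub hi hf, hf0, sub_zero]
  rw [h1]
  refine (mul_le_mul_right (enorm_integral_le_lintegral_enorm _) _).trans ?_
  rw [← lintegral_const_mul' _ _ (by finiteness), ← lintegral_const_mul' _ _ (by finiteness)]
  refine lintegral_mono fun y => ?_
  rw [← mul_assoc]
  rcases le_or_gt (4 * ‖y‖) R with hy | hy
  · simp [cutoff_eq_one hR hy]
  · rw [← ENNReal.ofReal_mul (by positivity), ← Real.mul_rpow (by norm_num) (norm_nonneg _)]
    gcongr
    rw [← ofReal_norm, ← ofReal_norm]
    refine ENNReal.ofReal_le_ofReal ?_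
    rw [show cutoff R y • f y - f y = (cutoff R y - 1) • f y by rw [sub_smul, one_smul], norm_smul,
      Real.norm_eq_abs, abs_of_nonpos (by linarith [cutoff_le_one R y])]
    exact mul_le_of_le_one_left (norm_nonneg _) (by linarith [cutoff_nonneg R y])

theorem exists_setLIntegral_ring_norm_rpow_le (hN : 2 ≤ N) {α : ℝ} (hα1 : α < 1) :
    ∃ C : ℝ≥0∞, C ≠ ∞ ∧ ∀ y : E, y ≠ 0 →
      ∫⁻ x in {x : E | ‖x‖ ≤ 4 * ‖y‖ ∧ 2 * ‖y‖ ≤ ‖x‖}, ENNReal.ofReal (‖x‖ ^ (α - N)) ≤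
        C * ENNReal.ofReal (‖y‖ ^ α) := by
  obtain ⟨C, hC, hle⟩ := exists_setLIntegral_compl_ball_norm_rpow_le (volume : Measure E)
    (s := α - 1 - N) (by rw [finrank_euclideanSpace_fin]; omega)
    (by rw [finrank_euclideanSpace_fin]; linarith)
  refine ⟨4 * C * ENNReal.ofReal (2 ^ (α - 1)), by finiteness, fun y hy => ?_⟩
  have hy' : 0 < ‖y‖ := norm_pos_iff.2 hy
  have hle' := hle (2 * ‖y‖) (by positivity)
  rw [finrank_euclideanSpace_fin, add_sub_cancel, Real.mul_rpow (by norm_num) hy'.le,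
    ENNReal.ofReal_mul (by positivity)] at hle'
  calc ∫⁻ x in {x : E | ‖x‖ ≤ 4 * ‖y‖ ∧ 2 * ‖y‖ ≤ ‖x‖}, ENNReal.ofReal (‖x‖ ^ (α - N))
      ≤ ∫⁻ x in {x : E | ‖x‖ ≤ 4 * ‖y‖ ∧ 2 * ‖y‖ ≤ ‖x‖},
          -- Trading one power of |x| for 4|y| makes the exponent integrable at infinity, as α < 1,
          -- so the exterior bound applies.
          ENNReal.ofReal (4 * ‖y‖) * ENNReal.ofReal (‖x‖ ^ (α - 1 - N)) := by
        refine setLIntegral_mono_ae (by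
          exact (measurable_const.mul (measurable_norm.pow_const _).ennreal_ofReal).aemeasurable)
          (.of_forall fun x hx => ?_)
        rw [← ENNReal.ofReal_mul (by positivity)]
        refine ENNReal.ofReal_le_ofReal ?_
        have hx0 : 0 < ‖x‖ := by linarith [hx.2]
        rw [show α - N = 1 + (α - 1 - N) by ring, Real.rpow_add hx0, Real.rpow_one]
        gcongr
        exact hx.1
    _ ≤ ∫⁻ x in {x : E | 2 * ‖y‖ ≤ ‖x‖},
          ENNReal.ofReal (4 * ‖y‖) * ENNReal.ofReal (‖x‖ ^ (α - 1 - N)) :=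
        lintegral_mono_set fun x hx => hx.2
    _ = ENNReal.ofReal (4 * ‖y‖) * ∫⁻ x in {x : E | 2 * ‖y‖ ≤ ‖x‖},
          ENNReal.ofReal (‖x‖ ^ (α - 1 - N)) := lintegral_const_mul' _ _ (by finiteness)
    _ ≤ ENNReal.ofReal (4 * ‖y‖) *
          (C * (ENNReal.ofReal (2 ^ (α - 1)) * ENNReal.ofReal (‖y‖ ^ (α - 1)))) := by gcongr
    _ = 4 * C * ENNReal.ofReal (2 ^ (α - 1)) * ENNReal.ofReal (‖y‖ ^ α) := by
        rw [show ‖y‖ ^ α = ‖y‖ * ‖y‖ ^ (α - 1) by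
          conv_lhs => rw [show α = 1 + (α - 1) by ring, Real.rpow_add hy', Real.rpow_one]]
        rw [ENNReal.ofReal_mul (by norm_num), ENNReal.ofReal_mul hy'.le]
        simp only [ENNReal.ofReal_ofNat]
        ring

end Cutoff

/-! ### Weighted L^q bounds for the cutoff mass and for the remainder kernel. -/

section WeightedKernel

variable {N : ℕ}

local notation "E" => EuclideanSpace ℝ (Fin N)

/-- The uniform bound on R^α |m(R)| is spent q - 1 times and the ring bound once. The latter is
integrated by Tonelli: for fixed y the admissible x satisfy 2|y| ≤ |x| ≤ 4|y|, and |x|^(α-N)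
integrates there to a multiple of |y|^α. -/
theorem exists_lintegral_rpow_cutoff_le (hN : 2 ≤ N) {α q : ℝ} (hα : 0 ≤ α) (hα1 : α < 1)
    (hq : 1 ≤ q) : ∃ C : ℝ≥0∞, C ≠ ∞ ∧ ∀ f g : E → EuclideanSpace ℂ (Fin N),
      IsGradientCorrection f g → Integrable f →
      ∫⁻ y, ENNReal.ofReal (‖y‖ ^ α) * ‖f y‖ₑ ≠ ∞ → ∫⁻ y, ENNReal.ofReal (‖y‖ ^ α) * ‖g y‖ₑ ≠ ∞ →
      ∫⁻ x : E, (ENNReal.ofReal (‖x‖ ^ (α - N / q)) * ‖∫ y, cutoff ‖x‖ y • f y‖ₑ) ^ q ≤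
        C * (∫⁻ y, ENNReal.ofReal (‖y‖ ^ α) * ‖f y‖ₑ) ^ (q - 1) *
          ((∫⁻ y, ENNReal.ofReal (‖y‖ ^ α) * ‖f y‖ₑ) +
            ∫⁻ y, ENNReal.ofReal (‖y‖ ^ α) * ‖g y‖ₑ) := by
  have hq0 : 0 < q := by linarith
  have hq1 : 0 ≤ q - 1 := by linarith
  obtain ⟨C₁, hC₁, h₁⟩ := exists_enorm_integral_cutoff_smul_le hN
  obtain ⟨C₂, hC₂, h₂⟩ := exists_setLIntegral_ring_norm_rpow_le hN hα1
  refine ⟨ENNReal.ofReal (4 ^ α) ^ (q - 1) * (C₁ * C₂), by finiteness, fun f g h hf ha hb => ?_⟩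
  set a := ∫⁻ y, ENNReal.ofReal (‖y‖ ^ α) * ‖f y‖ₑ with ha_def
  set b := ∫⁻ y, ENNReal.ofReal (‖y‖ ^ α) * ‖g y‖ₑ with hb_def
  have hf0 := integral_eq_zero_of_lintegral_ne_top hN h hf hα ha hb
  have hfm := h.contDiff_left.continuous.enorm.measurable
  have hgm := h.contDiff_right.continuous.enorm.measurable
  have : Nonempty (Fin N) := ⟨⟨0, by omega⟩⟩
  set P : E → E → ℝ≥0∞ := fun x y => ENNReal.ofReal (‖x‖ ^ (α - N)) *
    {z : E × E | ‖z.1‖ ≤ 4 * ‖z.2‖ ∧ 2 * ‖z.2‖ ≤ ‖z.1‖}.indicator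
      (fun z => ‖f z.2‖ₑ + ‖g z.2‖ₑ) (x, y) with hP
  have hset : MeasurableSet {z : E × E | ‖z.1‖ ≤ 4 * ‖z.2‖ ∧ 2 * ‖z.2‖ ≤ ‖z.1‖} := by
    have h1 : MeasurableSet {z : E × E | ‖z.1‖ ≤ 4 * ‖z.2‖} :=
      measurableSet_le (by fun_prop) (by fun_prop)
    have h2 : MeasurableSet {z : E × E | 2 * ‖z.2‖ ≤ ‖z.1‖} :=
      measurableSet_le (by fun_prop) (by fun_prop)
    exact h1.inter h2
  have hPm : Measurable (Function.uncurry P) := by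
    refine ((measurable_norm.comp measurable_fst).pow_const _).ennreal_ofReal.mul
      (Measurable.indicator ?_ hset)
    exact (hfm.comp measurable_snd).add (hgm.comp measurable_snd)
  have hpt : ∀ x : E, x ≠ 0 →
      (ENNReal.ofReal (‖x‖ ^ (α - N / q)) * ‖∫ y, cutoff ‖x‖ y • f y‖ₑ) ^ q ≤
        (ENNReal.ofReal (4 ^ α) * a) ^ (q - 1) * C₁ * ∫⁻ y, P x y := fun x hx => by
    have hx' : 0 < ‖x‖ := norm_pos_iff.2 hx
    have hsup := rpow_mul_enorm_integral_cutoff_smul_le hf hf0 hα hx'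
    have hring := h₁ f g h ‖x‖ hx'
    set F := ‖∫ y, cutoff ‖x‖ y • f y‖ₑ
    have hFtop : F ≠ ∞ := by simp [F]
    calc (ENNReal.ofReal (‖x‖ ^ (α - N / q)) * F) ^ q
        -- The exponents match: (α - N/q) q = α (q - 1) + (α - N).
        = (ENNReal.ofReal (‖x‖ ^ α) * F) ^ (q - 1) *
            (ENNReal.ofReal (‖x‖ ^ (α - N)) * F) := by
          rw [ENNReal.mul_rpow_of_nonneg _ _ hq0.le, ENNReal.mul_rpow_of_nonneg _ _ hq1,
            ENNReal.ofReal_rpow_of_nonneg (by positivity) hq0.le,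
            ENNReal.ofReal_rpow_of_nonneg (by positivity) hq1, ← Real.rpow_mul hx'.le,
            ← Real.rpow_mul hx'.le]
          rw [mul_mul_mul_comm, ← ENNReal.ofReal_mul (by positivity), ← Real.rpow_add hx']
          congr 1
          · congr 2
            field_simp; ring
          · conv_rhs => rw [← ENNReal.rpow_one F, ← ENNReal.rpow_mul, one_mul]
            rw [← ENNReal.rpow_add_of_nonneg _ _ hq1 zero_le_one]
            congr 1; ring
      _ ≤ (ENNReal.ofReal (4 ^ α) * a) ^ (q - 1) * (ENNReal.ofReal (‖x‖ ^ (α - N)) *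
            (C₁ * ∫⁻ y in {y : E | ‖x‖ ≤ 4 * ‖y‖ ∧ 2 * ‖y‖ ≤ ‖x‖}, (‖f y‖ₑ + ‖g y‖ₑ))) := by
          gcongr
      _ = (ENNReal.ofReal (4 ^ α) * a) ^ (q - 1) * C₁ * ∫⁻ y, P x y := by
          simp only [hP]
          rw [lintegral_const_mul' _ _ (by finiteness), ← lintegral_indicator (measurableSet_ring _),
            mul_left_comm (ENNReal.ofReal (‖x‖ ^ (α - N))), ← mul_assoc]
          rfl
  have hswap : ∫⁻ x, ∫⁻ y, P x y ≤ C₂ * (a + b) := by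
    rw [lintegral_lintegral_swap hPm.aemeasurable, ha_def, hb_def, ← lintegral_add_left (by
      exact ((measurable_norm.pow_const α).ennreal_ofReal.mul hfm)), ← lintegral_const_mul' _ _ hC₂]
    refine lintegral_mono_ae ?_
    filter_upwards [Measure.ae_ne volume (0 : E)] with y hy
    have h3 : ∀ x, P x y = {x : E | ‖x‖ ≤ 4 * ‖y‖ ∧ 2 * ‖y‖ ≤ ‖x‖}.indicator
        (fun x => ENNReal.ofReal (‖x‖ ^ (α - N))) x * (‖f y‖ₑ + ‖g y‖ₑ) := fun x => by
      simp only [hP]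
      by_cases hx : ‖x‖ ≤ 4 * ‖y‖ ∧ 2 * ‖y‖ ≤ ‖x‖
      · rw [Set.indicator_of_mem (by exact hx), Set.indicator_of_mem (by exact hx)]
      · rw [Set.indicator_of_notMem (by exact hx), Set.indicator_of_notMem (by exact hx), mul_zero,
          zero_mul]
    simp only [h3]
    have h4 : MeasurableSet {x : E | ‖x‖ ≤ 4 * ‖y‖ ∧ 2 * ‖y‖ ≤ ‖x‖} :=
      measurable_prodMk_right hset
    rw [lintegral_mul_const' _ _ (by finiteness), lintegral_indicator h4, ← mul_add, ← mul_assoc]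
    gcongr
    exact h₂ y hy
  calc ∫⁻ x : E, (ENNReal.ofReal (‖x‖ ^ (α - N / q)) * ‖∫ y, cutoff ‖x‖ y • f y‖ₑ) ^ q
      ≤ ∫⁻ x : E, (ENNReal.ofReal (4 ^ α) * a) ^ (q - 1) * C₁ * ∫⁻ y, P x y := by
        refine lintegral_mono_ae ?_
        filter_upwards [Measure.ae_ne volume (0 : E)] with x hx
        exact hpt x hx
    _ = (ENNReal.ofReal (4 ^ α) * a) ^ (q - 1) * C₁ * ∫⁻ x : E, ∫⁻ y, P x y :=
        lintegral_const_mul' _ _ (by finiteness)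
    _ ≤ (ENNReal.ofReal (4 ^ α) * a) ^ (q - 1) * C₁ * (C₂ * (a + b)) := by gcongr
    _ = _ := by
        rw [ENNReal.mul_rpow_of_nonneg _ _ hq1]
        ring

/-- The kernel dominating `K (x - y) - cutoff ‖x‖ y • K x`. -/
noncomputable def remainderKernel (l : ℝ) (x y : E) : ℝ :=
  if 4 * ‖y‖ ≤ ‖x‖ then ‖y‖ * ‖x‖ ^ (l - N - 1) else ‖x - y‖ ^ (l - N)

theorem remainderKernel_nonneg (l : ℝ) (x y : E) : 0 ≤ remainderKernel l x y := by
  unfold remainderKernel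
  split_ifs <;> positivity

theorem measurable_remainderKernel (l : ℝ) :
    Measurable (Function.uncurry (remainderKernel l : E → E → ℝ)) := by
  refine Measurable.ite ?_ ?_ ?_
  · exact measurableSet_le (by fun_prop) (by fun_prop)
  · exact measurable_snd.norm.mul (measurable_fst.norm.pow_const _)
  · exact (measurable_fst.sub measurable_snd).norm.pow_const _

/-- Needed for s = -β, whose sign is not fixed; adding both endpoint values covers either
monotonicity. -/
theorem rpow_le_of_mem_Icc {c d t s : ℝ} (hc : 0 < c) (hct : c ≤ t) (htd : t ≤ d) :
    t ^ s ≤ c ^ s + d ^ s := by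
  have ht : 0 < t := hc.trans_le hct
  rcases le_total 0 s with hs | hs
  · linarith [Real.rpow_le_rpow ht.le htd hs, Real.rpow_nonneg hc.le s]
  · linarith [Real.rpow_le_rpow_of_nonpos hc hct hs, Real.rpow_nonneg (ht.le.trans htd) s]

/-- Three regions, each scaling like |y|^(qα). Far out (|x| ≥ 4|y|), convergence at infinity is α <
1; near the origin (|x| < |y|/2), integrability of |x|^(-βq) is β < N/q; in between, the singularity
at x = y is integrable because α + β > 0. -/
theorem exists_lintegral_remainderKernel_rpow_le (hN : 2 ≤ N) {l α β q : ℝ} (hlN : l < N)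
    (hα1 : α < 1) (hq : 1 ≤ q) (hβ : β < N / q) (hαβ : 0 < α + β)
    (hscale : 1 / q = 1 + (α + β - l) / N) :
    ∃ C : ℝ≥0∞, C ≠ ∞ ∧ ∀ y : E, y ≠ 0 →
      ∫⁻ x : E, ENNReal.ofReal (‖x‖ ^ (-β) * remainderKernel l x y) ^ q ≤
        C * ENNReal.ofReal (‖y‖ ^ α) ^ q := by
  have hq0 : 0 < q := by linarith
  have hN0 : (0 : ℝ) < N := by
    have : (2 : ℝ) ≤ N := by exact_mod_cast hN
    linarith
  -- The scaling relation cleared of denominators; it simplifies the exponents in all three regions.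
  have hNq : (N : ℝ) = q * (N + α + β - l) := by
    field_simp at hscale; linarith
  have hd : 1 ≤ Module.finrank ℝ E := by rw [finrank_euclideanSpace_fin]; omega
  have hβq : β * q < N := (lt_div_iff₀ hq0).1 hβ
  have hmeasr : ∀ s : ℝ, Measurable fun x : E => ENNReal.ofReal (‖x‖ ^ s) := fun s =>
    (measurable_norm.pow_const s).ennreal_ofReal
  obtain ⟨C₁, hC₁, h₁⟩ := exists_setLIntegral_compl_ball_norm_rpow_le (volume : Measure E)
    (s := (-β + (l - N - 1)) * q) hd (by rw [finrank_euclideanSpace_fin]; nlinarith)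
  obtain ⟨C₂, hC₂, h₂⟩ := exists_setLIntegral_ball_norm_rpow_le (volume : Measure E)
    (s := -β * q) hd (by rw [finrank_euclideanSpace_fin]; linarith)
  obtain ⟨C₃, hC₃, h₃⟩ := exists_setLIntegral_ball_norm_rpow_le (volume : Measure E)
    (s := (l - N) * q) hd (by rw [finrank_euclideanSpace_fin]; nlinarith [mul_pos hq0 hαβ])
  rw [finrank_euclideanSpace_fin] at h₁ h₂ h₃
  set B : ℝ := (1 / 2) ^ (-β) + 4 ^ (-β) with hB
  refine ⟨C₁ * ENNReal.ofReal (4 ^ (q * (α - 1))) + (C₂ * ENNReal.ofReal ((1 / 2) ^ (q * α)) +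
    C₃ * ENNReal.ofReal (B ^ q * 5 ^ (q * (α + β)))), by finiteness, fun y hy => ?_⟩
  have hr : 0 < ‖y‖ := norm_pos_iff.2 hy
  set r := ‖y‖ with hr_def
  have hms : ∀ c : ℝ, MeasurableSet {x : E | c ≤ ‖x‖} := fun c =>
    measurableSet_le measurable_const (by fun_prop)
  have hrα : ENNReal.ofReal (r ^ α) ^ q = ENNReal.ofReal (r ^ (q * α)) := by
    rw [ENNReal.ofReal_rpow_of_nonneg (by positivity) hq0.le, ← Real.rpow_mul hr.le, mul_comm]
  have hfar : ∫⁻ x in {x : E | 4 * r ≤ ‖x‖},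
      ENNReal.ofReal (‖x‖ ^ (-β) * remainderKernel l x y) ^ q ≤
        C₁ * ENNReal.ofReal (4 ^ (q * (α - 1))) * ENNReal.ofReal (r ^ (q * α)) := by
    calc _ ≤ ∫⁻ x in {x : E | 4 * r ≤ ‖x‖},
          ENNReal.ofReal (r ^ q) * ENNReal.ofReal (‖x‖ ^ ((-β + (l - N - 1)) * q)) := by
          refine setLIntegral_mono ((hmeasr _).const_mul _) fun x (hx : 4 * r ≤ ‖x‖) => ?_
          have hx0 : 0 < ‖x‖ := by linarith
          rw [ENNReal.ofReal_rpow_of_nonneg (mul_nonneg (by positivity)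
            (remainderKernel_nonneg _ _ _)) hq0.le, ← ENNReal.ofReal_mul (by positivity)]
          refine ENNReal.ofReal_le_ofReal (le_of_eq ?_)
          rw [remainderKernel, if_pos hx, Real.rpow_mul hx0.le, Real.rpow_add hx0,
            ← Real.mul_rpow hr.le (by positivity)]
          congr 1; ring
      _ ≤ ENNReal.ofReal (r ^ q) *
          (C₁ * ENNReal.ofReal ((4 * r) ^ (N + (-β + (l - N - 1)) * q))) := by
          rw [lintegral_const_mul' _ _ (by finiteness)]
          gcongr
          exact h₁ _ (by positivity)
      _ = _ := by
          rw [show N + (-β + (l - N - 1)) * q = q * (α - 1) by linear_combination hNq,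
            Real.mul_rpow (by norm_num) hr.le, ENNReal.ofReal_mul (by positivity),
            show r ^ (q * α) = r ^ q * r ^ (q * (α - 1)) by
              rw [← Real.rpow_add hr]; congr 1; ring,
            ENNReal.ofReal_mul (by positivity)]
          ring
  have hnear : ∫⁻ x in {x : E | ‖x‖ < r / 2},
      ENNReal.ofReal (‖x‖ ^ (-β) * remainderKernel l x y) ^ q ≤
        C₂ * ENNReal.ofReal ((1 / 2) ^ (q * α)) * ENNReal.ofReal (r ^ (q * α)) := by
    calc _ ≤ ∫⁻ x in {x : E | ‖x‖ < r / 2},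
          ENNReal.ofReal ((r / 2) ^ ((l - N) * q)) * ENNReal.ofReal (‖x‖ ^ (-β * q)) := by
          refine setLIntegral_mono ((hmeasr _).const_mul _) fun x (hx : ‖x‖ < r / 2) => ?_
          have hxr : ¬ 4 * ‖y‖ ≤ ‖x‖ := by rw [← hr_def]; linarith
          have hxy : r / 2 ≤ ‖x - y‖ := by
            have := norm_sub_norm_le y x
            rw [norm_sub_rev] at this
            linarith
          rw [ENNReal.ofReal_rpow_of_nonneg (mul_nonneg (by positivity)
            (remainderKernel_nonneg _ _ _)) hq0.le, ← ENNReal.ofReal_mul (by positivity)]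
          refine ENNReal.ofReal_le_ofReal ?_
          rw [remainderKernel, if_neg hxr, Real.rpow_mul (norm_nonneg _), Real.rpow_mul (by positivity),
            ← Real.mul_rpow (by positivity) (by positivity), mul_comm]
          have := Real.rpow_le_rpow_of_nonpos (by positivity) hxy (by linarith : l - N ≤ 0)
          gcongr
      _ ≤ ENNReal.ofReal ((r / 2) ^ ((l - N) * q)) *
          (C₂ * ENNReal.ofReal ((r / 2) ^ (N + -β * q))) := by
          rw [lintegral_const_mul' _ _ (by finiteness)]
          gcongr
          exact h₂ _ (by positivity)
      _ = _ := by
          rw [mul_left_comm, ← ENNReal.ofReal_mul (by positivity), ← Real.rpow_add (by positivity),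
            show (l - N) * q + (N + -β * q) = q * α by linear_combination hNq, mul_assoc,
            ← ENNReal.ofReal_mul (by positivity), ← Real.mul_rpow (by norm_num) hr.le,
            one_div_mul_eq_div]
  have hmid : ∫⁻ x in {x : E | r / 2 ≤ ‖x‖ ∧ ‖x‖ < 4 * r},
      ENNReal.ofReal (‖x‖ ^ (-β) * remainderKernel l x y) ^ q ≤
        C₃ * ENNReal.ofReal (B ^ q * 5 ^ (q * (α + β))) * ENNReal.ofReal (r ^ (q * α)) := by
    have hBpos : 0 ≤ B := by positivity
    calc _ ≤ ∫⁻ x in {x : E | r / 2 ≤ ‖x‖ ∧ ‖x‖ < 4 * r},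
          ENNReal.ofReal ((B * r ^ (-β)) ^ q) * ENNReal.ofReal (‖x - y‖ ^ ((l - N) * q)) := by
          refine setLIntegral_mono (((hmeasr _).comp (measurable_id.sub_const y)).const_mul _)
            fun x hx => ?_
          have hxr : ¬ 4 * ‖y‖ ≤ ‖x‖ := not_le.2 hx.2
          rw [ENNReal.ofReal_rpow_of_nonneg (mul_nonneg (by positivity)
            (remainderKernel_nonneg _ _ _)) hq0.le, ← ENNReal.ofReal_mul (by positivity)]
          refine ENNReal.ofReal_le_ofReal ?_
          rw [remainderKernel, if_neg hxr, Real.rpow_mul (norm_nonneg _),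
            ← Real.mul_rpow (by positivity) (by positivity)]
          have hxB : ‖x‖ ^ (-β) ≤ B * r ^ (-β) := by
            have h5 := rpow_le_of_mem_Icc (c := 1 / 2) (d := 4) (t := ‖x‖ / r) (s := -β)
              (by norm_num) (by rw [le_div_iff₀ hr]; linarith [hx.1])
              (by rw [div_le_iff₀ hr]; exact hx.2.le)
            rwa [Real.div_rpow (norm_nonneg _) hr.le, div_le_iff₀ (by positivity)] at h5
          gcongr
      _ ≤ ∫⁻ x in {x : E | ‖x - y‖ < 5 * r},
          ENNReal.ofReal ((B * r ^ (-β)) ^ q) * ENNReal.ofReal (‖x - y‖ ^ ((l - N) * q)) := by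
          refine lintegral_mono_set fun x hx => ?_
          have := norm_sub_le x y
          have h6 := hx.2
          show ‖x - y‖ < 5 * r
          linarith
      _ = ENNReal.ofReal ((B * r ^ (-β)) ^ q) *
            ∫⁻ x in {x : E | ‖x‖ < 5 * r}, ENNReal.ofReal (‖x‖ ^ ((l - N) * q)) := by
          rw [lintegral_const_mul' _ _ (by finiteness), ← lintegral_indicator (by
            exact measurableSet_lt (by fun_prop) measurable_const), ← lintegral_indicator (by
            exact measurableSet_lt (by fun_prop) measurable_const)]
          congr 1
          exact lintegral_sub_right_eq_self ({x : E | ‖x‖ < 5 * r}.indicator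
            fun x => ENNReal.ofReal (‖x‖ ^ ((l - N) * q))) y
      _ ≤ ENNReal.ofReal ((B * r ^ (-β)) ^ q) *
            (C₃ * ENNReal.ofReal ((5 * r) ^ (N + (l - N) * q))) := by
          gcongr
          exact h₃ _ (by positivity)
      _ = _ := by
          rw [show N + (l - N) * q = q * (α + β) by linear_combination hNq, mul_left_comm,
            ← ENNReal.ofReal_mul (by positivity), mul_assoc, ← ENNReal.ofReal_mul (by positivity),
            Real.mul_rpow hBpos (by positivity), Real.mul_rpow (by norm_num) hr.le,
            ← Real.rpow_mul hr.le]
          congr 2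
          rw [show r ^ (q * α) = r ^ (-β * q) * r ^ (q * (α + β)) by
              rw [← Real.rpow_add hr]; congr 1; ring]
          ring
  rw [hrα, add_mul, add_mul]
  have hsplit : (Set.univ : Set E) ⊆ {x : E | 4 * r ≤ ‖x‖} ∪
      ({x : E | ‖x‖ < r / 2} ∪ {x : E | r / 2 ≤ ‖x‖ ∧ ‖x‖ < 4 * r}) := fun x _ => by
    rcases le_or_gt (4 * r) ‖x‖ with h | h
    · exact Or.inl h
    · rcases lt_or_ge ‖x‖ (r / 2) with h' | h'
      · exact Or.inr (Or.inl h')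
      · exact Or.inr (Or.inr ⟨h', h⟩)
  rw [← setLIntegral_univ]
  refine (lintegral_mono_set hsplit).trans ((lintegral_union_le _ _ _).trans ?_)
  exact add_le_add hfar ((lintegral_union_le _ _ _).trans (add_le_add hnear hmid))

end WeightedKernel

/-! ### The convolution operator: absolute convergence, decomposition and the combined estimate. -/

section SteinWeiss

variable {N : ℕ}

local notation "E" => EuclideanSpace ℝ (Fin N)

variable {V : Type*} [NormedAddCommGroup V] [NormedSpace ℂ V]

theorem aestronglyMeasurable_convolution_integrand
    {K : E → (EuclideanSpace ℂ (Fin N) →L[ℂ] V)} (hK : AEStronglyMeasurable K volume)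
    {f : E → EuclideanSpace ℂ (Fin N)} (hf : AEStronglyMeasurable f volume) (x : E) :
    AEStronglyMeasurable (fun y => K (x - y) (f y)) volume :=
  (ContinuousLinearMap.id ℂ (EuclideanSpace ℂ (Fin N) →L[ℂ] V)).aestronglyMeasurable_comp₂
    (hK.comp_quasiMeasurePreserving (quasiMeasurePreserving_sub_left volume x)) hf

/-- Split at |x - y| = 1: inside, |x - y|^(l-N) is integrable because l > 0 and f is bounded;
outside, the kernel is bounded because l < N and f is integrable. -/
theorem integrable_convolution_integrand (hN : 2 ≤ N) {l : ℝ} (hl : 0 < l) (hlN : l < N)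
    {K : E → (EuclideanSpace ℂ (Fin N) →L[ℂ] V)} (hK : AEStronglyMeasurable K volume) {A : ℝ}
    (hKsize : ∀ x, x ≠ 0 → ‖K x‖ ≤ A * ‖x‖ ^ (l - N)) {f : E → EuclideanSpace ℂ (Fin N)}
    (hf : Integrable f) {B : ℝ} (hB : ∀ y, ‖f y‖ ≤ B) (x : E) :
    Integrable (fun y => K (x - y) (f y)) volume := by
  have : Nonempty (Fin N) := ⟨⟨0, by omega⟩⟩
  have hloc : Integrable ((Metric.ball (0 : E) 1).indicator fun z => ‖z‖ ^ (l - N)) := by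
    rw [integrable_indicator_iff measurableSet_ball]
    refine integrableOn_ball_of_norm_le_rpow (C := 1) (α := N - l) ?_ ?_ (.of_forall fun z => ?_)
      (measurable_norm.pow_const _).aestronglyMeasurable
    · rw [finrank_euclideanSpace_fin]; omega
    · rw [finrank_euclideanSpace_fin]; linarith
    · rw [Real.norm_of_nonneg (by positivity), neg_sub, one_mul]
  refine Integrable.mono' (((hloc.comp_sub_left x).const_mul (|A| * B)).add
    (hf.norm.const_mul |A|)) (aestronglyMeasurable_convolution_integrand hK hf.1 x) ?_
  filter_upwards [Measure.ae_ne volume x] with y hy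
  have hxy : x - y ≠ 0 := sub_ne_zero.2 hy.symm
  have hxy' : 0 < ‖x - y‖ := norm_pos_iff.2 hxy
  have h1 : ‖K (x - y) (f y)‖ ≤ |A| * ‖x - y‖ ^ (l - N) * ‖f y‖ := by
    refine ((K (x - y)).le_opNorm _).trans ?_
    gcongr
    exact (hKsize _ hxy).trans (by gcongr; exact le_abs_self A)
  refine h1.trans ?_
  simp only [Pi.add_apply]
  have hB0 : 0 ≤ B := (norm_nonneg _).trans (hB y)
  by_cases h : x - y ∈ Metric.ball (0 : E) 1
  · rw [Set.indicator_of_mem h]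
    have h2 : |A| * ‖x - y‖ ^ (l - N) * ‖f y‖ ≤ |A| * ‖x - y‖ ^ (l - N) * B := by
      gcongr; exact hB y
    have h3 : 0 ≤ |A| * ‖f y‖ := by positivity
    linarith
  · rw [Set.indicator_of_notMem h, mul_zero, zero_add]
    have h2 : ‖x - y‖ ^ (l - N) ≤ 1 :=
      Real.rpow_le_one_of_one_le_of_nonpos (by simpa using h) (by linarith)
    gcongr
    exact mul_le_of_le_one_right (abs_nonneg A) h2

/-- For |x| ≥ 4|y| the cutoff is 1 and kernel smoothness applies; for |x| ≤ 2|y| it is 0 and the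
size bound suffices. In the transition |x - y| ≤ 2|x|, so the size bound for K(x) is absorbed into
that for K(x - y) at the cost of 2^(N-l). -/
theorem norm_kernel_sub_cutoff_smul_le {l : ℝ} (hlN : l < N)
    {K : E → (EuclideanSpace ℂ (Fin N) →L[ℂ] V)} {A : ℝ}
    (hKsize : ∀ x, x ≠ 0 → ‖K x‖ ≤ A * ‖x‖ ^ (l - N))
    (hKsmooth : ∀ x y, x ≠ 0 → 2 * ‖y‖ ≤ ‖x‖ →
      ‖K (x - y) - K x‖ ≤ A * (‖y‖ / ‖x‖ ^ (N + 1 - l))) {x y : E} (hx : x ≠ 0) (hxy : x ≠ y) :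
    ‖K (x - y) - cutoff ‖x‖ y • K x‖ ≤
      |A| * (1 + 2 ^ (N - l)) * remainderKernel l x y := by
  have hx' : 0 < ‖x‖ := norm_pos_iff.2 hx
  have hxy0 : x - y ≠ 0 := sub_ne_zero.2 hxy
  have hxy' : 0 < ‖x - y‖ := norm_pos_iff.2 hxy0
  have hone : 1 ≤ 1 + (2 : ℝ) ^ (N - l) := le_add_of_nonneg_right (by positivity)
  have hKxy : ‖K (x - y)‖ ≤ |A| * ‖x - y‖ ^ (l - N) :=
    (hKsize _ hxy0).trans (by gcongr; exact le_abs_self A)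
  unfold remainderKernel
  split_ifs with h
  · rw [cutoff_eq_one hx' h, one_smul]
    refine (hKsmooth x y hx (by linarith [norm_nonneg y])).trans ?_
    rw [show l - N - 1 = -(N + 1 - l) by ring, Real.rpow_neg hx'.le, ← div_eq_mul_inv]
    gcongr
    exact (le_abs_self A).trans (le_mul_of_one_le_right (abs_nonneg A) hone)
  · rcases le_or_gt ‖x‖ (2 * ‖y‖) with h' | h'
    · rw [cutoff_eq_zero hx' h', zero_smul, sub_zero]
      refine hKxy.trans ?_
      gcongr
      exact le_mul_of_one_le_right (abs_nonneg A) hone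
    · have hle : ‖x - y‖ / 2 ≤ ‖x‖ := by linarith [norm_sub_le x y, norm_nonneg x]
      have h1 : ‖x‖ ^ (l - N) ≤ 2 ^ (N - l) * ‖x - y‖ ^ (l - N) := by
        refine (Real.rpow_le_rpow_of_nonpos (by positivity) hle (by linarith)).trans (le_of_eq ?_)
        rw [Real.div_rpow hxy'.le (by norm_num), div_eq_inv_mul, ← Real.rpow_neg (by norm_num),
          neg_sub]
      have h2 : ‖cutoff ‖x‖ y • K x‖ ≤ |A| * (2 ^ (N - l) * ‖x - y‖ ^ (l - N)) := by
        rw [norm_smul, Real.norm_of_nonneg (cutoff_nonneg _ _)]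
        refine (mul_le_of_le_one_left (norm_nonneg _) (cutoff_le_one _ _)).trans ?_
        refine (hKsize x hx).trans ?_
        gcongr
        exact le_abs_self A
      refine (norm_sub_le _ _).trans ((add_le_add hKxy h2).trans (le_of_eq ?_))
      ring

theorem convOperator_eq_add_cutoff [CompleteSpace V]
    {K : E → (EuclideanSpace ℂ (Fin N) →L[ℂ] V)}
    {f : E → EuclideanSpace ℂ (Fin N)} (hf : Integrable f) {x : E}
    (hint : Integrable (fun y => K (x - y) (f y)) volume) :
    convOperator K f x = (∫ y, (K (x - y) - cutoff ‖x‖ y • K x) (f y)) +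
      K x (∫ y, cutoff ‖x‖ y • f y) := by
  have hi : Integrable fun y => cutoff ‖x‖ y • f y :=
    hf.mono ((contDiff_cutoff _).continuous.aestronglyMeasurable.smul hf.1)
      (.of_forall fun y => by
        rw [norm_smul, Real.norm_of_nonneg (cutoff_nonneg _ _)]
        exact mul_le_of_le_one_left (norm_nonneg _) (cutoff_le_one _ _))
  have hsub : ∀ y, (K (x - y) - cutoff ‖x‖ y • K x) (f y) =
      K (x - y) (f y) - K x (cutoff ‖x‖ y • f y) := fun y => by
    rw [sub_apply, smul_apply, ← Complex.coe_smul, ← Complex.coe_smul, map_smul]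
  simp only [hsub]
  rw [integral_sub hint ((K x).integrable_comp hi), (K x).integral_comp_comm hi, sub_add_cancel]
  rfl

theorem rpow_mul_enorm_convOperator_le [CompleteSpace V] (hN : 2 ≤ N) {l β : ℝ} (hlN : l < N)
    {K : E → (EuclideanSpace ℂ (Fin N) →L[ℂ] V)} {A : ℝ}
    (hKsize : ∀ x, x ≠ 0 → ‖K x‖ ≤ A * ‖x‖ ^ (l - N))
    (hKsmooth : ∀ x y, x ≠ 0 → 2 * ‖y‖ ≤ ‖x‖ →
      ‖K (x - y) - K x‖ ≤ A * (‖y‖ / ‖x‖ ^ (N + 1 - l)))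
    {f : E → EuclideanSpace ℂ (Fin N)} (hf : Integrable f) {x : E} (hx : x ≠ 0)
    (hint : Integrable (fun y => K (x - y) (f y)) volume) :
    ENNReal.ofReal (‖x‖ ^ (-β)) * ‖convOperator K f x‖ₑ ≤
      ENNReal.ofReal (|A| * (1 + 2 ^ (N - l))) *
        ((∫⁻ y, ENNReal.ofReal (‖x‖ ^ (-β) * remainderKernel l x y) * ‖f y‖ₑ) +
          ENNReal.ofReal (‖x‖ ^ (l - N - β)) * ‖∫ y, cutoff ‖x‖ y • f y‖ₑ) := by
  have : Nonempty (Fin N) := ⟨⟨0, by omega⟩⟩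
  have hx' : 0 < ‖x‖ := norm_pos_iff.2 hx
  set D : ℝ := |A| * (1 + 2 ^ (N - l)) with hD
  have hD0 : 0 ≤ D := by positivity
  rw [convOperator_eq_add_cutoff hf hint]
  refine (mul_le_mul_right (enorm_add_le _ _) _).trans ?_
  rw [mul_add, mul_add]
  refine add_le_add ?_ ?_
  · refine (mul_le_mul_right (enorm_integral_le_lintegral_enorm _) _).trans ?_
    rw [← lintegral_const_mul' _ _ (by finiteness), ← lintegral_const_mul' _ _ (by finiteness)]
    refine lintegral_mono_ae ?_
    filter_upwards [Measure.ae_ne volume x] with y hy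
    rw [← mul_assoc, ← ENNReal.ofReal_mul hD0, ← ofReal_norm, ← ofReal_norm,
      ← ENNReal.ofReal_mul (by positivity), ← ENNReal.ofReal_mul (mul_nonneg hD0
        (mul_nonneg (by positivity) (remainderKernel_nonneg _ _ _)))]
    refine ENNReal.ofReal_le_ofReal ?_
    calc _ ≤ ‖x‖ ^ (-β) * (D * remainderKernel l x y * ‖f y‖) := by
          gcongr
          refine (ContinuousLinearMap.le_opNorm _ _).trans ?_
          gcongr
          exact norm_kernel_sub_cutoff_smul_le hlN hKsize hKsmooth hx hy.symm
      _ = _ := by ring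
  · rw [← mul_assoc, ← ENNReal.ofReal_mul hD0, ← ofReal_norm, ← ofReal_norm,
      ← ENNReal.ofReal_mul (by positivity), ← ENNReal.ofReal_mul (by positivity)]
    refine ENNReal.ofReal_le_ofReal ?_
    have hKx : ‖K x‖ ≤ D * ‖x‖ ^ (l - N) := by
      refine (hKsize x hx).trans ?_
      gcongr
      exact (le_abs_self A).trans (le_mul_of_one_le_right (abs_nonneg A)
        (le_add_of_nonneg_right (by positivity)))
    calc _ ≤ ‖x‖ ^ (-β) * (D * ‖x‖ ^ (l - N) * ‖∫ y, cutoff ‖x‖ y • f y‖) := by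
          gcongr
          exact ((K x).le_opNorm _).trans (by gcongr)
      _ = _ := by
          rw [sub_eq_add_neg (l - N) β, Real.rpow_add hx']
          ring

theorem exists_lintegral_rpow_convOperator_le [CompleteSpace V] (hN : 2 ≤ N) {l α β q : ℝ}
    (hl : 0 < l) (hlN : l < N) (hα : 0 ≤ α) (hα1 : α < 1) (hq : 1 ≤ q) (hβ : β < N / q)
    (hαβ : 0 < α + β) (hscale : 1 / q = 1 + (α + β - l) / N)
    {K : E → (EuclideanSpace ℂ (Fin N) →L[ℂ] V)} (hK : AEStronglyMeasurable K volume) {A : ℝ}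
    (hKsize : ∀ x, x ≠ 0 → ‖K x‖ ≤ A * ‖x‖ ^ (l - N))
    (hKsmooth : ∀ x y, x ≠ 0 → 2 * ‖y‖ ≤ ‖x‖ →
      ‖K (x - y) - K x‖ ≤ A * (‖y‖ / ‖x‖ ^ (N + 1 - l))) :
    ∃ C : ℝ≥0∞, C ≠ ∞ ∧ ∀ f g : E → EuclideanSpace ℂ (Fin N), IsGradientCorrection f g →
      Integrable f → (∃ B, ∀ y, ‖f y‖ ≤ B) →
      ∫⁻ y, ENNReal.ofReal (‖y‖ ^ α) * ‖f y‖ₑ ≠ ∞ → ∫⁻ y, ENNReal.ofReal (‖y‖ ^ α) * ‖g y‖ₑ ≠ ∞ →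
      ∫⁻ x, (ENNReal.ofReal (‖x‖ ^ (-β)) * ‖convOperator K f x‖ₑ) ^ q ≤
        C * (∫⁻ y, ENNReal.ofReal (‖y‖ ^ α) * ‖f y‖ₑ) ^ (q - 1) *
          ((∫⁻ y, ENNReal.ofReal (‖y‖ ^ α) * ‖f y‖ₑ) +
            ∫⁻ y, ENNReal.ofReal (‖y‖ ^ α) * ‖g y‖ₑ) := by
  have hq0 : 0 < q := by linarith
  have hq1 : 0 ≤ q - 1 := by linarith
  have : Nonempty (Fin N) := ⟨⟨0, by omega⟩⟩
  -- By scaling, the power multiplying m(|x|) is exactly the one in the cutoff mass estimate.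
  have hexp : l - N - β = α - N / q := by
    have hN0 : (N : ℝ) ≠ 0 := by simp; omega
    rw [div_eq_mul_one_div (N : ℝ) q, hscale]
    field_simp
    ring
  obtain ⟨C₁, hC₁, h₁⟩ := exists_lintegral_rpow_cutoff_le hN hα hα1 hq
  obtain ⟨C₂, hC₂, h₂⟩ := exists_lintegral_remainderKernel_rpow_le hN hlN hα1 hq hβ hαβ hscale
  set D : ℝ≥0∞ := ENNReal.ofReal (|A| * (1 + 2 ^ (N - l))) with hD
  refine ⟨D ^ q * 2 ^ (q - 1) * (C₂ + C₁), by finiteness, fun f g h hf hB ha hb => ?_⟩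
  obtain ⟨B, hB⟩ := hB
  have hfm := h.contDiff_left.continuous.enorm.measurable
  have hw : Measurable fun y : E => ENNReal.ofReal (‖y‖ ^ α) :=
    (measurable_norm.pow_const α).ennreal_ofReal
  have hS : Measurable (Function.uncurry fun x y : E =>
      ENNReal.ofReal (‖x‖ ^ (-β) * remainderKernel l x y)) :=
    ((measurable_fst.norm.pow_const _).mul (measurable_remainderKernel l)).ennreal_ofReal
  have hschur := lintegral_rpow_lintegral_mul_le (μ := (volume : Measure E)) hS hw hfm (by
      filter_upwards [Measure.ae_ne volume (0 : E)] with y hy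
      have : 0 < ‖y‖ := norm_pos_iff.2 hy
      exact ⟨by simp; positivity, by finiteness⟩) hq (by
      filter_upwards [Measure.ae_ne volume (0 : E)] with y hy
      exact h₂ y hy)
  have hcut := h₁ f g h hf ha hb
  set a := ∫⁻ y, ENNReal.ofReal (‖y‖ ^ α) * ‖f y‖ₑ with ha_def
  set b := ∫⁻ y, ENNReal.ofReal (‖y‖ ^ α) * ‖g y‖ₑ with hb_def
  set G₁ : E → ℝ≥0∞ := fun x =>
    ∫⁻ y, ENNReal.ofReal (‖x‖ ^ (-β) * remainderKernel l x y) * ‖f y‖ₑ with hG₁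
  set G₂ : E → ℝ≥0∞ := fun x =>
    ENNReal.ofReal (‖x‖ ^ (α - N / q)) * ‖∫ y, cutoff ‖x‖ y • f y‖ₑ with hG₂
  have hG₁m : Measurable G₁ := by
    refine Measurable.lintegral_prod_right' (f := fun z : E × E =>
      ENNReal.ofReal (‖z.1‖ ^ (-β) * remainderKernel l z.1 z.2) * ‖f z.2‖ₑ) ?_
    exact hS.mul (hfm.comp measurable_snd)
  calc ∫⁻ x, (ENNReal.ofReal (‖x‖ ^ (-β)) * ‖convOperator K f x‖ₑ) ^ q
      ≤ ∫⁻ x, D ^ q * 2 ^ (q - 1) * (G₁ x ^ q + G₂ x ^ q) := by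
        refine lintegral_mono_ae ?_
        filter_upwards [Measure.ae_ne volume (0 : E)] with x hx
        have h3 := rpow_mul_enorm_convOperator_le (β := β) hN hlN hKsize hKsmooth hf hx
          (integrable_convolution_integrand hN hl hlN hK hKsize hf hB x)
        rw [hexp] at h3
        refine (ENNReal.rpow_le_rpow h3 hq0.le).trans ?_
        rw [ENNReal.mul_rpow_of_nonneg _ _ hq0.le, mul_assoc (D ^ q)]
        gcongr
        exact ENNReal.rpow_add_le_mul_rpow_add_rpow _ _ hq
    _ = D ^ q * 2 ^ (q - 1) * ((∫⁻ x, G₁ x ^ q) + ∫⁻ x, G₂ x ^ q) := by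
        rw [lintegral_const_mul' _ _ (by finiteness), lintegral_add_left (hG₁m.pow_const q)]
    _ ≤ D ^ q * 2 ^ (q - 1) * (C₂ * (a ^ (q - 1) * (a + b)) + C₁ * a ^ (q - 1) * (a + b)) := by
        gcongr
        refine hschur.trans ?_
        gcongr
        calc a ^ q = a ^ (q - 1) * a := by
              conv_rhs => rw [← ENNReal.rpow_one a, ← ENNReal.rpow_mul, one_mul]
              rw [← ENNReal.rpow_add_of_nonneg _ _ hq1 zero_le_one, sub_add_cancel]
          _ ≤ a ^ (q - 1) * (a + b) := by gcongr; exact le_self_add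
    _ = _ := by ring

theorem powerWeightNorm_eq_lintegral {G : Type*} [NormedAddCommGroup G] (γ : ℝ) {p : ℝ}
    (hp : 0 < p) (F : E → G) : powerWeightNorm γ p F =
      (∫⁻ x, (ENNReal.ofReal (‖x‖ ^ γ) * ‖F x‖ₑ) ^ p) ^ (1 / p) := by
  rw [powerWeightNorm, eLpNorm_eq_lintegral_rpow_enorm_toReal (by simpa using hp) (by finiteness),
    ENNReal.toReal_ofReal hp.le]
  congr 2
  funext x
  rw [enorm_mul, enorm_norm, Real.enorm_of_nonneg (by positivity)]

theorem powerWeightNorm_one {G : Type*} [NormedAddCommGroup G] (γ : ℝ) (F : E → G) :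
    powerWeightNorm γ 1 F = ∫⁻ x, ENNReal.ofReal (‖x‖ ^ γ) * ‖F x‖ₑ := by
  rw [powerWeightNorm_eq_lintegral γ one_pos]
  simp

end SteinWeiss

/-! ### From the product estimate to the two inequalities. -/

/-- The constant is absorbed entirely by the a in a^(q-1), so b keeps coefficient 1. -/
theorem ENNReal.mul_rpow_sub_one_mul_le {a b D C : ℝ≥0∞} {q : ℝ} (hq : 1 ≤ q) (hD : 1 ≤ D)
    (hCD : C ≤ D ^ (q - 1)) : C * a ^ (q - 1) * (a + b) ≤ (D * a + b) ^ q := by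
  have hq1 : 0 ≤ q - 1 := by linarith
  calc C * a ^ (q - 1) * (a + b) ≤ D ^ (q - 1) * a ^ (q - 1) * (D * a + b) := by
        gcongr
        exact le_mul_of_one_le_left zero_le hD
    _ = (D * a) ^ (q - 1) * (D * a + b) := by rw [ENNReal.mul_rpow_of_nonneg _ _ hq1]
    _ ≤ (D * a + b) ^ (q - 1) * (D * a + b) := by gcongr; exact le_self_add
    _ = (D * a + b) ^ q := by
        conv_lhs => rw [← ENNReal.rpow_one (D * a + b), ← ENNReal.rpow_mul, one_mul]
        rw [← ENNReal.rpow_add_of_nonneg _ _ hq1 zero_le_one, sub_add_cancel]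

theorem mainTheorem6 {N : ℕ} (hN : 2 ≤ N) {l α β q : ℝ}
    (hl : 0 < l) (hlN : l < N) (hα : 0 ≤ α) (hα1 : α < 1)
    (hq : 1 ≤ q) (hβ : β < N / q) (hαβ : 0 < α + β)
    (hscale : 1 / q = 1 + (α + β - l) / N)
    {V : Type*} [NormedAddCommGroup V] [NormedSpace ℂ V] [FiniteDimensional ℂ V]
    (K : EuclideanSpace ℝ (Fin N) → (EuclideanSpace ℂ (Fin N) →L[ℂ] V))
    (hKmeas : AEStronglyMeasurable K volume) {A : ℝ}
    (hKsize : ∀ x, x ≠ 0 → ‖K x‖ ≤ A * ‖x‖ ^ (l - N))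
    (hKsmooth : ∀ x y, x ≠ 0 → 2 * ‖y‖ ≤ ‖x‖ →
      ‖K (x - y) - K x‖ ≤ A * (‖y‖ / ‖x‖ ^ (N + 1 - l))) :
    (∀ (f : 𝓢(EuclideanSpace ℝ (Fin N), EuclideanSpace ℂ (Fin N))) (x),
      Integrable (fun y => K (x - y) (f y)) volume) ∧
    (∃ C : ℝ, 0 < C ∧ ∀ f : 𝓢(EuclideanSpace ℝ (Fin N), EuclideanSpace ℂ (Fin N)),
      powerWeightNorm (-β) q (convOperator K f) ≤
        ENNReal.ofReal C *
          (powerWeightNorm α 1 f + powerWeightNorm α 1 (gradInvLaplacianDiv f))) ∧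
    (1 < q →
      ∃ C : ℝ, 0 < C ∧ ∀ f : 𝓢(EuclideanSpace ℝ (Fin N), EuclideanSpace ℂ (Fin N)),
        powerWeightNorm (-β) q (convOperator K f) ≤
          ENNReal.ofReal C * powerWeightNorm α 1 f +
            powerWeightNorm α 1 (gradInvLaplacianDiv f)) := by
  have hcomplete : CompleteSpace V := FiniteDimensional.complete ℂ V
  have hq0 : 0 < q := by linarith
  have hbdd : ∀ f : 𝓢(EuclideanSpace ℝ (Fin N), EuclideanSpace ℂ (Fin N)),
      ∃ B, ∀ y, ‖f y‖ ≤ B := fun f => by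
    obtain ⟨C, -, hC⟩ := f.decay 0 0
    exact ⟨C, fun y => by simpa using hC y⟩
  obtain ⟨C, hC, hmain⟩ := exists_lintegral_rpow_convOperator_le hN hl hlN hα hα1 hq hβ hαβ hscale
    hKmeas hKsize hKsmooth
  -- Both norms must be finite here, since the vanishing of ∫ f depends on it; otherwise the
  -- right-hand sides of the claims are infinite.
  have key : ∀ f : 𝓢(EuclideanSpace ℝ (Fin N), EuclideanSpace ℂ (Fin N)),
      powerWeightNorm α 1 f ≠ ∞ → powerWeightNorm α 1 (gradInvLaplacianDiv f) ≠ ∞ →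
      powerWeightNorm (-β) q (convOperator K f) ≤
        (C * powerWeightNorm α 1 f ^ (q - 1) *
          (powerWeightNorm α 1 f + powerWeightNorm α 1 (gradInvLaplacianDiv f))) ^ (1 / q) :=
    fun f ha hb => by
      rw [powerWeightNorm_eq_lintegral _ hq0]
      rw [powerWeightNorm_one] at ha hb ⊢
      rw [powerWeightNorm_one]
      exact ENNReal.rpow_le_rpow (hmain f _ (isGradientCorrection_gradInvLaplacianDiv hN f)
        f.integrable (hbdd f) ha hb) (by positivity)
  refine ⟨fun f x => ?_, ?_, fun hq1 => ?_⟩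
  · obtain ⟨B, hB⟩ := hbdd f
    exact integrable_convolution_integrand hN hl hlN hKmeas hKsize f.integrable hB x
  -- The added 1 only ensures D > 0, as C may vanish.
  · set D : ℝ := (C ^ (1 / q)).toReal + 1 with hD
    have hDC : C ^ (1 / q) ≤ ENNReal.ofReal D := by
      rw [ENNReal.le_ofReal_iff_toReal_le (by finiteness) (by positivity)]
      linarith
    have hD0 : 0 < D := by positivity
    refine ⟨D, hD0, fun f => ?_⟩
    set a := powerWeightNorm α 1 f
    set b := powerWeightNorm α 1 (gradInvLaplacianDiv f)
    by_cases hab : a + b = ∞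
    · rw [hab, ENNReal.mul_top (by simpa using hD0)]
      exact le_top
    obtain ⟨ha, hb⟩ := ENNReal.add_ne_top.1 hab
    refine (key f ha hb).trans ?_
    have h1 := ENNReal.mul_rpow_sub_one_mul_le (a := a) (b := b) (D := 1) (C := 1) hq le_rfl
      (by simp)
    rw [one_mul, one_mul] at h1
    calc (C * a ^ (q - 1) * (a + b)) ^ (1 / q) ≤ (C * (a + b) ^ q) ^ (1 / q) := by
          rw [mul_assoc]
          gcongr
      _ = C ^ (1 / q) * (a + b) := by
          rw [ENNReal.mul_rpow_of_nonneg _ _ (by positivity), ← ENNReal.rpow_mul,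
            mul_one_div_cancel hq0.ne', ENNReal.rpow_one]
      _ ≤ _ := by gcongr
  · have hq1' : 0 < q - 1 := by linarith
    -- Chosen so that D^(q-1) ≥ C and D ≥ 1; solving for D is where q > 1 is needed.
    set D : ℝ := (C ^ (1 / (q - 1))).toReal + 1 with hD
    have hDC : C ^ (1 / (q - 1)) ≤ ENNReal.ofReal D := by
      rw [ENNReal.le_ofReal_iff_toReal_le (by finiteness) (by positivity)]
      linarith
    have hD1 : 1 ≤ D := le_add_of_nonneg_left ENNReal.toReal_nonneg
    have hD0 : 0 < D := by linarith
    refine ⟨D, hD0, fun f => ?_⟩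
    set a := powerWeightNorm α 1 f
    set b := powerWeightNorm α 1 (gradInvLaplacianDiv f)
    by_cases ha : a = ∞
    · rw [ha, ENNReal.mul_top (by simpa using hD0), top_add]
      exact le_top
    by_cases hb : b = ∞
    · rw [hb, add_top]
      exact le_top
    refine (key f ha hb).trans ?_
    have hCD : C ≤ ENNReal.ofReal D ^ (q - 1) := by
      refine le_of_eq_of_le ?_ (ENNReal.rpow_le_rpow hDC hq1'.le)
      rw [← ENNReal.rpow_mul, one_div_mul_cancel hq1'.ne', ENNReal.rpow_one]
    calc (C * a ^ (q - 1) * (a + b)) ^ (1 / q) ≤ ((ENNReal.ofReal D * a + b) ^ q) ^ (1 / q) := by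
          gcongr
          exact ENNReal.mul_rpow_sub_one_mul_le hq (by simpa using hD1) hCD
      _ = _ := by
          rw [← ENNReal.rpow_mul, mul_one_div_cancel hq0.ne', ENNReal.rpow_one]
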